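/- Let $A:[1,\infty)\to(0,\infty)$ be a non-decreasing function that is either $C^1$ or continuous and piecewise linear with breakpoints that do not accumulate at a finite point; in the second case $A'(s)$ denotes the left derivative for $s>1$ and $A'(1)$ the right derivative. Put $M_0=1$, $M_j=M_{j-1}A(j)$ for $j\ge 1$, and let $\mathcal C_A([0,1])$ be the class of real functions $f\in C^\infty([0,1])$ with $\|f^{(j)}\|_{[0,1]}\le M_j$ for all $j\ge 0$, where $\|f\|_K=\sup_K|f|$. The Bang degree $\mathfrak n_f$ of $f\in\mathcal C_A([0,1])$ is the largest integer $N\ge 0$ such that $$\sum_{\log \|f\|_{[0,1]}^{-1}<j\le N}\frac{M_{j-1}}{M_j}<e ,$$ and $\mathfrak n_f=+\infty$ if the set of such $N$ is unbounded (an empty sum is $0$, and $\log\|f\|_{[0,1]}^{-1}=+\infty$ if $f=0$). For $x\ge 1$ let $$\gamma(x)=\sup_{1\le s\le x}\frac{sA'(s)}{A(s)},\qquad \Gamma(x)=4e^{4+\gamma(x)} .$$ Theorem B. Let $f\in\mathcal C_A([0,1])$ with $1\le \mathfrak n_f<\infty$. Then for every interval $I\subset[0,1]$ and every Lebesgue measurable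 set $E\subset I$ of positive length $|E|$, $$\|f\|_I\le\left(\frac{\Gamma(2\mathfrak n_f)\,|I|}{|E|}\right)^{2\mathfrak n_f}\|f\|_E .$$ -/

import Mathlib

open Set Filter Topology MeasureTheory
open scoped ContDiff

noncomputable section

namespace DenjoyCarleman

/-- The supremum norm `‖f‖_K = sup_K |f|`. -/
def supNorm (f : ℝ → ℝ) (K : Set ℝ) : ℝ :=
  sSup ((fun x => |f x|) '' K)

/-- The sequence `M 0 = 1`, `M j = M (j - 1) * A j` for `j ≥ 1`. -/
def M (A : ℝ → ℝ) (j : ℕ) : ℝ :=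
  ∏ i ∈ Finset.range j, A ((i + 1 : ℕ) : ℝ)

/-- The normalized Denjoy-Carleman class `C_A([0,1])`: the real functions that are smooth on
`[0,1]` (with one-sided derivatives at the end points) and satisfy `‖f^(j)‖_[0,1] ≤ M j` for all
`j ≥ 0`. -/
def carlemanClass (A : ℝ → ℝ) : Set (ℝ → ℝ) :=
  {f | ContDiffOn ℝ ∞ f (Icc 0 1) ∧
    ∀ j : ℕ, ∀ x ∈ Icc (0 : ℝ) 1, |iteratedDerivWithin j f (Icc 0 1) x| ≤ M A j}

open Classical in
/-- The sum of `M (j - 1) / M j` over the integers `j` with `log (1 / ‖f‖_[0,1]) < j ≤ N`. It is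
empty for `‖f‖_[0,1] = 0`, where `log (1 / ‖f‖_[0,1]) = +∞`. For a member `f` of the class,
`log (1 / ‖f‖_[0,1]) ≥ 0`, so that all these `j` are positive. -/
def bangSum (A f : ℝ → ℝ) (N : ℕ) : ℝ :=
  ∑ j ∈ (Finset.Icc 1 N).filter
      (fun j : ℕ => 0 < supNorm f (Icc 0 1) ∧ Real.log (supNorm f (Icc 0 1))⁻¹ < (j : ℝ)),
    M A (j - 1) / M A j

/-- The Bang degree: the largest `N` with `bangSum A f N < e`, and `⊤` if these `N` are
unbounded. (`N = 0` always satisfies the condition, the sum being empty.) -/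
def bangDegree (A f : ℝ → ℝ) : ℕ∞ :=
  ⨆ N ∈ {N : ℕ | bangSum A f N < Real.exp 1}, (N : ℕ∞)

/-- `A` is (continuous and) piecewise linear on `[1, ∞)`: linear on each of the intervals between
consecutive breakpoints `1 = t 0 < t 1 < t 2 < ...`, which tend to infinity. -/
def IsPiecewiseLinear (A : ℝ → ℝ) : Prop :=
  ∃ t : ℕ → ℝ, t 0 = 1 ∧ StrictMono t ∧ Tendsto t atTop atTop ∧
    ∀ i : ℕ, ∃ a b : ℝ, ∀ s ∈ Icc (t i) (t (i + 1)), A s = a * s + b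

/-- The left derivative of `A` at `s > 1`, and the right derivative at the end point `s = 1` of
`[1, ∞)`. If `A` is `C^1` on `[1, ∞)`, this is the derivative of `A` (see
`derivA_eq_of_contDiffOn`). -/
def derivA (A : ℝ → ℝ) (s : ℝ) : ℝ :=
  if s = 1 then derivWithin A (Ici 1) 1 else derivWithin A (Iic s) s

/-- `γ(x) = sup_{1 ≤ s ≤ x} s A'(s) / A(s)`. -/
def gammaA (A : ℝ → ℝ) (x : ℝ) : ℝ :=
  sSup ((fun s => s * derivA A s / A s) '' Icc 1 x)

/-- `Γ(x) = 4 e^{4 + γ(x)}`. -/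
def GammaA (A : ℝ → ℝ) (x : ℝ) : ℝ :=
  4 * Real.exp (4 + gammaA A x)

/-- For a `C^1` function on `[1, ∞)`, `derivA` is the ordinary derivative relative to `[1, ∞)`. -/
theorem derivA_eq_of_contDiffOn {A : ℝ → ℝ} (hA : ContDiffOn ℝ 1 A (Ici 1)) {s : ℝ}
    (hs : 1 ≤ s) : derivA A s = derivWithin A (Ici 1) s := by
  unfold derivA
  split_ifs with h
  · rw [h]
  · have h1 : 1 < s := lt_of_le_of_ne hs (Ne.symm h)
    have hd : DifferentiableAt ℝ A s :=
      ((hA.differentiableOn one_ne_zero) s hs).differentiableAt (Ici_mem_nhds h1)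
    rw [hd.derivWithin (uniqueDiffOn_Iic s s self_mem_Iic),
      hd.derivWithin (uniqueDiffOn_Ici (1 : ℝ) s hs)]

end DenjoyCarleman

end

/-! Let `P` interpolate `f` in degree at most `n` at `n + 1` points of `E` whose consecutive gaps
are at least `d = |E| / (n + 1)`. The derivatives of `P` are controlled by `δ = ‖f‖_E`
(`abs_eval_iterate_derivative_interpolate_le`), and `f - P` on `I` by the Abel-Gontcharoff remainder
`M_(n+1) |I|^(n+1) / (n+1)!` (`abs_le_of_interpolation`). It remains to exclude that `δ` is tiny
compared with this remainder; here the Bang degree enters.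

By Rolle, the derivatives of `f - P` have a chain of zeros `ξ_0, ..., ξ_n`, so that `f^(j)(ξ_j) =
P^(j)(ξ_j)`, and from any `x` in `[0,1]` such a chain can be run through within length 1
(`exists_short_zero_chain`). Bang's theorem: if `f^(j)(ξ_j) = 0` for all `j` and the way from `x`
through the chain is at most `x_k = (1/e) ∑_{k ≤ l ≤ n+1} 1/A(l)`, then `|f(x)| ≤ e^(-k)`. The
version needed allows small values instead of zeros (`abs_le_exp_neg_of_small_chain`). It is proved
by majorizing `|f^(j)| / M_j` by a function `h_j` of the length of the way, where `h_j` arises from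
`h_(j+1)`, capped at 1, by integration; the bound for `h_j` grows by a factor `e` between `x_(i+1)`
and `x_i`. For the least integer `k > log(1/‖f‖)`, the definition of `n` gives `x_k ≥ 1`. If all
`P^(j)(ξ_j)` were small, then `‖f‖ ≤ e^(-k)`, a contradiction. Hence, for some `j`, the upper bound
for `P^(j)` is not small, which bounds `Q = δ (2|I|/|E|)^n` from below by a multiple of `M_j |I|^j`
(`exists_lt_of_bangDegree`).

Finally `A(t)/A(s) ≤ (t/s)^γ` compares `M_j` with `A(n+1)^j`. If `|I| A(n+1) ≥ n + 1`, the lower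
bound says `1 ≤ CQ`, which suffices as `|f| ≤ 1`; otherwise `M_(n+1) |I|^(n+1)` is dominated through
`M_j |I|^j`, and the remainder is at most `CQ` (`le_mul_exp_of_bounds`). -/

/-! ### Integrals of capped profiles and exponential inequalities -/

theorem intervalIntegral_le_sub_of_le_deriv {g Φ Φ' : ℝ → ℝ} {u v : ℝ} (huv : u ≤ v)
    (hg : Continuous g) (hΦ : ∀ s, HasDerivAt Φ (Φ' s) s) (hΦ' : Continuous Φ')
    (h : ∀ s ∈ Icc u v, g s ≤ Φ' s) : ∫ s in u..v, g s ≤ Φ v - Φ u := by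
  rw [← intervalIntegral.integral_eq_sub_of_hasDerivAt (fun s _ => hΦ s)
    (hΦ'.intervalIntegrable u v)]
  exact intervalIntegral.integral_mono_on huv (hg.intervalIntegrable u v)
    (hΦ'.intervalIntegrable u v) h

theorem integral_sub_eq {g : ℝ → ℝ} (hg : Continuous g) (u v : ℝ) :
    ∫ s in (0 : ℝ)..v, g s = (∫ s in (0 : ℝ)..u, g s) + ∫ s in u..v, g s :=
  (intervalIntegral.integral_add_adjacent_intervals (hg.intervalIntegrable 0 u)
    (hg.intervalIntegrable u v)).symm

theorem integral_min_one_le_quadratic {h : ℝ → ℝ} (hh : Continuous h) {x t a c : ℝ} (hxt : x ≤ t)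
    (hb : ∀ s ∈ Icc x t, h s ≤ c + (s - x) / a) :
    ∫ s in x..t, min 1 (h s) ≤ c * (t - x) + (t - x) ^ 2 / (2 * a) := by
  have := intervalIntegral_le_sub_of_le_deriv (g := fun s => min 1 (h s))
    (Φ := fun s => c * (s - x) + (s - x) ^ 2 / (2 * a)) (Φ' := fun s => c + (s - x) / a) hxt
    (continuous_const.min hh) (fun s => by
      have h1 : HasDerivAt (fun s : ℝ => s - x) 1 s := (hasDerivAt_id s).sub_const x
      refine ((h1.const_mul c).add ((h1.pow 2).div_const (2 * a))).congr_deriv ?_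
      norm_num
      ring) (by fun_prop) (fun s hs => (min_le_right _ _).trans (hb s hs))
  simpa using this

theorem integral_min_one_le_length {h : ℝ → ℝ} (hh : Continuous h) {x t : ℝ} (hxt : x ≤ t) :
    ∫ s in x..t, min 1 (h s) ≤ t - x := by
  have := intervalIntegral_le_sub_of_le_deriv (g := fun s => min 1 (h s))
    (Φ := fun s => s) (Φ' := fun _ => 1) hxt
    (continuous_const.min hh) (fun s => hasDerivAt_id s) (by fun_prop)
    (fun s _ => min_le_left _ _)
  simpa using this

theorem integral_min_one_le_split {h : ℝ → ℝ} (hh : Continuous h) {x t a c y : ℝ} (hxy : x ≤ y)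
    (hyt : y ≤ t) (hb : ∀ s ∈ Icc x t, h s ≤ c + (s - x) / a) :
    ∫ s in x..t, min 1 (h s) ≤ c * (y - x) + (y - x) ^ 2 / (2 * a) + (t - y) := by
  have hg : Continuous (fun s => min 1 (h s)) := continuous_const.min hh
  rw [← intervalIntegral.integral_add_adjacent_intervals (hg.intervalIntegrable x y)
    (hg.intervalIntegrable y t)]
  exact add_le_add (integral_min_one_le_quadratic hh hxy
    (fun s hs => hb s ⟨hs.1, hs.2.trans hyt⟩)) (integral_min_one_le_length hh hyt)

theorem exp_one_mul_le_exp (w : ℝ) : Real.exp 1 * w ≤ Real.exp w := by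
  have h := Real.add_one_le_exp (w - 1)
  have : Real.exp w = Real.exp 1 * Real.exp (w - 1) := by rw [← Real.exp_add]; ring_nf
  rw [this]
  exact mul_le_mul_of_nonneg_left (by linarith) (Real.exp_pos 1).le

/-- The left side is convex in `r`. At both ends of `[w²/2, 1]` it equals `1 + w + w²/2`; at both
ends of `[w/2, w]` it equals `5w/2 ≤ e w ≤ e^w`. -/
theorem quadratic_profile_le_exp {r w : ℝ} (hr : 0 < r) (hr1 : r ≤ 1) (hw : 0 ≤ w)
    (hrw : w / 2 ≤ r) : r + w + w ^ 2 / (2 * r) ≤ Real.exp w := by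
  have he := Real.exp_one_gt_d9
  have h1 : 1 + w + w ^ 2 / 2 ≤ Real.exp w := Real.quadratic_le_exp_of_nonneg hw
  have h2 := exp_one_mul_le_exp w
  have h3 : 5 / 2 * w ≤ Real.exp w := by nlinarith
  rcases le_total (w ^ 2 / 2) r with hc | hc
  · have : r + w ^ 2 / (2 * r) ≤ 1 + w ^ 2 / 2 := by
      have : w ^ 2 / (2 * r) = (w ^ 2 / 2) / r := by field_simp
      rw [this, ← sub_nonneg]
      have : 1 + w ^ 2 / 2 - (r + w ^ 2 / 2 / r) = (1 - r) * (r - w ^ 2 / 2) / r := by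
        field_simp
        ring
      rw [this]
      exact div_nonneg (mul_nonneg (by linarith) (by linarith)) hr.le
    linarith
  · have : r + w ^ 2 / (2 * r) ≤ w / 2 + w := by
      rw [← sub_nonneg]
      have : w / 2 + w - (r + w ^ 2 / (2 * r)) = (r - w / 2) * (w - r) / r := by
        field_simp
        ring
      rw [this]
      refine div_nonneg (mul_nonneg (by linarith) ?_) hr.le
      nlinarith
    linarith

/-- Since `(e - 1)²/2 > 1`, the terms in `r` contribute at most 0, and `e w ≤ e^w` remains. -/
theorem split_profile_le_exp {r w : ℝ} (hr : 0 ≤ r) :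
    r + Real.exp 1 * w - r * (Real.exp 1 - 1) ^ 2 / 2 ≤ Real.exp w := by
  have he := Real.exp_one_gt_d9
  have h2 := exp_one_mul_le_exp w
  nlinarith [mul_nonneg hr (by nlinarith : 0 ≤ (Real.exp 1 - 1) ^ 2 / 2 - 1)]

/-! ### Levels, profiles and the induction step of Bang's theorem -/

/-- The partial sums `x_i = (a_i + ... + a_L) / e`, decreasing in `i`, with `x_(L+1) = 0`. -/
noncomputable def levelPoint (a : ℕ → ℝ) (L i : ℕ) : ℝ :=
  (∑ l ∈ Finset.Ico i (L + 1), a l) / Real.exp 1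

theorem levelPoint_top (a : ℕ → ℝ) (L : ℕ) : levelPoint a L (L + 1) = 0 := by
  simp [levelPoint]

theorem levelPoint_eq_add (a : ℕ → ℝ) {L i : ℕ} (hi : i ≤ L) :
    levelPoint a L i = levelPoint a L (i + 1) + a i / Real.exp 1 := by
  unfold levelPoint
  rw [Finset.sum_eq_sum_Ico_succ_bot (by omega)]
  ring

theorem levelPoint_nonneg {a : ℕ → ℝ} {L i : ℕ} (ha : ∀ l, i ≤ l → l ≤ L → 0 < a l) :
    0 ≤ levelPoint a L i :=
  div_nonneg (Finset.sum_nonneg fun l hl => by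
    rw [Finset.mem_Ico] at hl
    exact (ha l hl.1 (by omega)).le) (Real.exp_pos 1).le

/-- The bound `e^(j - i - 1) exp (e (t - x_(i+1)) / a_i)` on `[x_(i+1), x_i]`; it increases from
`e^(j-i-1)` to `e^(j-i)` there. -/
noncomputable def levelBound (a : ℕ → ℝ) (L j i : ℕ) (t : ℝ) : ℝ :=
  Real.exp ((j : ℝ) - i - 1 + Real.exp 1 * (t - levelPoint a L (i + 1)) / a i)

/-- A majorant for `|f^(j)| / M_j` as a function of the distance travelled. -/
structure IsProfile (a : ℕ → ℝ) (L j : ℕ) (h : ℝ → ℝ) : Prop where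
  cont : Continuous h
  nonneg : ∀ t, 0 ≤ t → 0 ≤ h t
  mono : ∀ s t, 0 ≤ s → s ≤ t → h s ≤ h t
  slope : ∀ s t, 0 ≤ s → s ≤ t → h t ≤ h s + (t - s) / a (j + 1)
  bound : ∀ i, j < i → i ≤ L → ∀ t ∈ Icc (levelPoint a L (i + 1)) (levelPoint a L i),
    h t ≤ levelBound a L j i t

theorem levelBound_left (a : ℕ → ℝ) (L j i : ℕ) :
    levelBound a L j i (levelPoint a L (i + 1)) = Real.exp ((j : ℝ) - i - 1) := by
  simp [levelBound]

theorem levelBound_right {a : ℕ → ℝ} {L j i : ℕ} (hi : i ≤ L) (ha : 0 < a i) :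
    levelBound a L j i (levelPoint a L i) = Real.exp ((j : ℝ) - i) := by
  rw [levelBound, levelPoint_eq_add a hi]
  congr 1
  field_simp
  ring

theorem hasDerivAt_levelBound (a : ℕ → ℝ) (L j i : ℕ) (hai : 0 < a i) (t : ℝ) :
    HasDerivAt (fun t => a i / Real.exp 1 * levelBound a L j i t) (levelBound a L j i t) t := by
  have h1 : HasDerivAt (fun t : ℝ => (j : ℝ) - i - 1 +
      Real.exp 1 * (t - levelPoint a L (i + 1)) / a i) (Real.exp 1 * 1 / a i) t :=
    ((((hasDerivAt_id t).sub_const _).const_mul _).div_const _).const_add _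
  refine (h1.exp.const_mul (a i / Real.exp 1)).congr_deriv ?_
  rw [levelBound]
  field_simp

theorem continuous_levelBound (a : ℕ → ℝ) (L j i : ℕ) : Continuous (levelBound a L j i) := by
  unfold levelBound
  fun_prop

/-- The passage from a majorant for the derivative to one for the function. -/
noncomputable def nextProfile (η b : ℝ) (h : ℝ → ℝ) (t : ℝ) : ℝ :=
  η + (∫ s in (0 : ℝ)..t, min 1 (h s)) / b

theorem continuous_nextProfile {η b : ℝ} {h : ℝ → ℝ} (hh : Continuous h) :
    Continuous (nextProfile η b h) := by
  unfold nextProfile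
  have hg : Continuous (fun s => min 1 (h s)) := continuous_const.min hh
  exact continuous_const.add ((intervalIntegral.continuous_primitive
    (fun u v => hg.intervalIntegrable u v) 0).div_const b)

theorem nextProfile_mono {η b : ℝ} {h : ℝ → ℝ} (hh : Continuous h) (hb : 0 < b)
    (h0 : ∀ t, 0 ≤ t → 0 ≤ h t) {s t : ℝ} (hs : 0 ≤ s) (hst : s ≤ t) :
    nextProfile η b h s ≤ nextProfile η b h t := by
  have hg : Continuous (fun s => min 1 (h s)) := continuous_const.min hh
  unfold nextProfile
  rw [integral_sub_eq hg s t]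
  have : 0 ≤ ∫ r in s..t, min 1 (h r) := intervalIntegral.integral_nonneg hst
    fun r hr => le_min zero_le_one (h0 r (hs.trans hr.1))
  gcongr
  linarith

theorem nextProfile_nonneg {η b : ℝ} {h : ℝ → ℝ} (hh : Continuous h) (hb : 0 < b) (hη : 0 ≤ η)
    (h0 : ∀ t, 0 ≤ t → 0 ≤ h t) {t : ℝ} (ht : 0 ≤ t) : 0 ≤ nextProfile η b h t := by
  refine le_trans ?_ (nextProfile_mono hh hb h0 le_rfl ht)
  simpa [nextProfile] using hη

theorem nextProfile_slope {η b : ℝ} {h : ℝ → ℝ} (hh : Continuous h) (hb : 0 < b)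
    {s t : ℝ} (hst : s ≤ t) :
    nextProfile η b h t ≤ nextProfile η b h s + (t - s) / b := by
  have hg : Continuous (fun s => min 1 (h s)) := continuous_const.min hh
  unfold nextProfile
  rw [integral_sub_eq hg s t, add_div, ← add_assoc]
  gcongr
  exact integral_min_one_le_length hh hst

/-- On the lower levels the primitive of a profile is governed by the level bound. -/
theorem IsProfile.integral_le {a : ℕ → ℝ} {L j : ℕ} {h : ℝ → ℝ} (hp : IsProfile a L j h)
    (ha : ∀ l, 1 ≤ l → l ≤ L → 0 < a l) (hanti : ∀ l, 1 ≤ l → l < L → a (l + 1) ≤ a l)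
    {i : ℕ} (hji : j < i) (hiL : i ≤ L) :
    ∀ t ∈ Icc (levelPoint a L (i + 1)) (levelPoint a L i),
      ∫ s in (0 : ℝ)..t, min 1 (h s) ≤
        a i / Real.exp 1 * (levelBound a L j i t - Real.exp ((j : ℝ) - L - 1)) := by
  have hg : Continuous (fun s => min 1 (h s)) := continuous_const.min hp.cont
  induction hiL using Nat.decreasingInduction with
  | self =>
    intro t ht
    rw [levelPoint_top] at ht
    have := intervalIntegral_le_sub_of_le_deriv ht.1 hg
      (hasDerivAt_levelBound a L j L (ha L (by omega) le_rfl)) (continuous_levelBound a L j L)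
      (fun s hs => (min_le_right _ _).trans (hp.bound L hji le_rfl s
        ⟨by rw [levelPoint_top]; exact hs.1, hs.2.trans ht.2⟩))
    refine this.trans (le_of_eq ?_)
    have h0 := levelBound_left a L j L
    rw [levelPoint_top] at h0
    rw [h0]
    ring
  | of_succ i hi ih =>
    intro t ht
    have hi1 := ha i (by omega) hi.le
    have h1 := ih (by omega) (levelPoint a L (i + 1))
      ⟨by rw [levelPoint_eq_add a (show i + 1 ≤ L from hi)]
          have := ha (i + 1) (by omega) hi
          have := div_pos this (Real.exp_pos 1)
          linarith, le_rfl⟩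
    rw [levelBound_right hi (ha (i + 1) (by omega) hi)] at h1
    have h2 := intervalIntegral_le_sub_of_le_deriv ht.1 hg
      (hasDerivAt_levelBound a L j i hi1) (continuous_levelBound a L j i)
      (fun s hs => (min_le_right _ _).trans (hp.bound i hji hi.le s ⟨hs.1, hs.2.trans ht.2⟩))
    rw [integral_sub_eq hg (levelPoint a L (i + 1)) t]
    have h3 : (j : ℝ) - ((i + 1 : ℕ) : ℝ) = (j : ℝ) - i - 1 := by push_cast; ring
    rw [h3] at h1
    rw [levelBound_left] at h2
    -- As `a` is decreasing, the coefficient `a (i + 1)` of the levels below may be raised to `a i`;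
    -- the boundary values at `x_(i+1)` then cancel.
    have h4 : a (i + 1) / Real.exp 1 * (Real.exp ((j : ℝ) - i - 1) - Real.exp ((j : ℝ) - L - 1)) ≤
        a i / Real.exp 1 * (Real.exp ((j : ℝ) - i - 1) - Real.exp ((j : ℝ) - L - 1)) := by
      apply mul_le_mul_of_nonneg_right
      · gcongr
        exact hanti i (by omega) hi
      · rw [sub_nonneg]
        apply Real.exp_le_exp.2
        have : (i : ℝ) ≤ L := by exact_mod_cast hi.le
        linarith
    calc _ ≤ _ := add_le_add (h1.trans h4) h2
      _ = _ := by ring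

theorem levelBound_succ (a : ℕ → ℝ) (L j i : ℕ) (t : ℝ) :
    levelBound a L (j + 1) i t = Real.exp 1 * levelBound a L j i t := by
  rw [levelBound, levelBound, ← Real.exp_add]
  congr 1
  push_cast
  ring

/-- Integrating the bound for index `j + 1` costs `a i / e ≤ a (j + 2) / e`, and the bound for `j +
1` is `e` times that for `j`; dividing by `a (j + 1)` leaves the ratio. The permitted `η` is exactly
the lower boundary term of the integral. -/
theorem IsProfile.nextProfile_le_low {a : ℕ → ℝ} {L j : ℕ} {h : ℝ → ℝ}
    (hp : IsProfile a L (j + 1) h)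
    (ha : ∀ l, 1 ≤ l → l ≤ L → 0 < a l) (hanti : ∀ l, 1 ≤ l → l < L → a (l + 1) ≤ a l)
    {η : ℝ} (hη : η ≤ a (j + 2) / a (j + 1) * Real.exp ((j : ℝ) - 1 - L))
    {i : ℕ} (hji : j + 1 < i) (hiL : i ≤ L)
    {t : ℝ} (ht : t ∈ Icc (levelPoint a L (i + 1)) (levelPoint a L i)) :
    nextProfile η (a (j + 1)) h t ≤ a (j + 2) / a (j + 1) * levelBound a L j i t := by
  have h1 := hp.integral_le ha hanti hji hiL t ht
  have hj1 := ha (j + 1) (by omega) (by omega)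
  have hai : a i ≤ a (j + 2) := by
    clear h1 ht hη
    induction i, (show j + 2 ≤ i from hji) using Nat.le_induction with
    | base => exact le_rfl
    | succ i hi ih => exact (hanti i (by omega) (by omega)).trans (ih (by omega) (by omega))
  have hE : Real.exp (((j + 1 : ℕ) : ℝ) - L - 1) ≤ levelBound a L (j + 1) i t := by
    apply Real.exp_le_exp.2
    have h2 : 0 ≤ Real.exp 1 * (t - levelPoint a L (i + 1)) / a i :=
      div_nonneg (mul_nonneg (Real.exp_pos 1).le (by linarith [ht.1]))
        (ha i (by omega) hiL).le
    have : (i : ℝ) ≤ L := by exact_mod_cast hiL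
    linarith
  have h2 : ∫ s in (0 : ℝ)..t, min 1 (h s) ≤
      a (j + 2) / Real.exp 1 *
        (levelBound a L (j + 1) i t - Real.exp (((j + 1 : ℕ) : ℝ) - L - 1)) := by
    refine h1.trans (mul_le_mul_of_nonneg_right ?_ (sub_nonneg.2 hE))
    gcongr
  have h3 : Real.exp (((j + 1 : ℕ) : ℝ) - L - 1) = Real.exp 1 * Real.exp ((j : ℝ) - 1 - L) := by
    rw [← Real.exp_add]
    congr 1
    push_cast
    ring
  unfold nextProfile
  rw [levelBound_succ, h3] at h2
  calc _ ≤ a (j + 2) / a (j + 1) * Real.exp ((j : ℝ) - 1 - L) + a (j + 2) / Real.exp 1 *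
        (Real.exp 1 * levelBound a L j i t - Real.exp 1 * Real.exp ((j : ℝ) - 1 - L))
          / a (j + 1) := by gcongr
    _ = _ := by
      field_simp
      ring

theorem IsProfile.next {a : ℕ → ℝ} {L j : ℕ} {h : ℝ → ℝ}
    (hp : IsProfile a L (j + 1) h) (hjL : j + 2 ≤ L)
    (ha : ∀ l, 1 ≤ l → l ≤ L → 0 < a l) (hanti : ∀ l, 1 ≤ l → l < L → a (l + 1) ≤ a l)
    {η : ℝ} (hη0 : 0 ≤ η) (hη : η ≤ a (j + 2) / a (j + 1) * Real.exp ((j : ℝ) - 1 - L)) :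
    IsProfile a L j (nextProfile η (a (j + 1)) h) := by
  have hj1 := ha (j + 1) (by omega) (by omega)
  have hj2 := ha (j + 2) (by omega) (by omega)
  have hr1 : a (j + 2) / a (j + 1) ≤ 1 :=
    (div_le_one hj1).2 (hanti (j + 1) (by omega) (by omega))
  refine ⟨continuous_nextProfile hp.cont, fun t ht => nextProfile_nonneg hp.cont hj1 hη0 hp.nonneg ht,
    fun s t hs hst => nextProfile_mono hp.cont hj1 hp.nonneg hs hst,
    fun s t _ hst => nextProfile_slope hp.cont hj1 hst, ?_⟩
  intro i hji hiL t ht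
  -- Level `j + 1` is new: the hypothesis bounds `h` only on levels above index `j + 1`. On the new
  -- level only the slope and the cap 1 are available, but the starting value `r e^(-2)` has gained
  -- the factor `r`.
  rcases (show j + 1 ≤ i from hji).eq_or_lt with rfl | hji'
  · set x := levelPoint a L (j + 1 + 1) with hx
    set r := a (j + 2) / a (j + 1) with hr
    have hr0 : 0 < r := div_pos hj2 hj1
    have hx0 : 0 ≤ x := levelPoint_nonneg fun l hl hl' => ha l (by omega) hl'
    have hmem : x ∈ Icc (levelPoint a L (j + 2 + 1)) (levelPoint a L (j + 2)) :=
      ⟨by rw [hx, levelPoint_eq_add a (show j + 2 ≤ L from hjL)]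
          have := div_pos hj2 (Real.exp_pos 1)
          linarith, le_rfl⟩
    have hstart := hp.nextProfile_le_low ha hanti hη (show j + 1 < j + 2 by omega) hjL hmem
    rw [hx, levelBound_right hjL hj2, ← hx] at hstart
    have hhx := hp.bound (j + 2) (by omega) hjL x hmem
    rw [hx, levelBound_right hjL hj2, ← hx] at hhx
    have e1 : ((j + 1 : ℕ) : ℝ) - ((j + 2 : ℕ) : ℝ) = -1 := by push_cast; ring
    have e2 : (j : ℝ) - ((j + 2 : ℕ) : ℝ) = -2 := by push_cast; ring
    rw [e1] at hhx
    rw [e2] at hstart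
    set w := Real.exp 1 * (t - x) / a (j + 1) with hw
    have hw0 : 0 ≤ w := div_nonneg (mul_nonneg (Real.exp_pos 1).le (by linarith [ht.1])) hj1.le
    have htw : t - x = a (j + 1) * w / Real.exp 1 := by rw [hw]; field_simp
    have haj : a (j + 2) = r * a (j + 1) := by rw [hr]; field_simp
    have hinc : nextProfile η (a (j + 1)) h t = nextProfile η (a (j + 1)) h x +
        (∫ s in x..t, min 1 (h s)) / a (j + 1) := by
      unfold nextProfile
      rw [integral_sub_eq (continuous_const.min hp.cont) x t]
      ring
    have hslope : ∀ s ∈ Icc x t, h s ≤ Real.exp (-1) + (s - x) / a (j + 2) := fun s hs =>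
      (hp.slope x s hx0 hs.1).trans (by gcongr)
    have hgoal : levelBound a L j (j + 1) t = Real.exp (-2) * Real.exp w := by
      rw [levelBound, ← Real.exp_add, hw]
      congr 1
      push_cast
      ring
    rw [hgoal, hinc]
    have he1 : Real.exp (-1) = 1 / Real.exp 1 := by rw [Real.exp_neg]; simp
    have he2 : Real.exp (-2) = 1 / Real.exp 1 ^ 2 := by
      rw [Real.exp_neg, ← Real.exp_nat_mul]; norm_num
    have hepos := Real.exp_pos 1
    -- For small `w` the linear bound for `h` is integrated throughout; for `w ≥ 2r` the cap 1 takes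
    -- over.
    rcases le_total (w / 2) r with hc | hc
    · have hI := integral_min_one_le_quadratic hp.cont ht.1 hslope
      have hq := quadratic_profile_le_exp hr0 hr1 hw0 hc
      calc _ ≤ r * Real.exp (-2) + (Real.exp (-1) * (t - x) +
            (t - x) ^ 2 / (2 * a (j + 2))) / a (j + 1) := by gcongr
        _ = Real.exp (-2) * (r + w + w ^ 2 / (2 * r)) := by
          rw [htw, haj, he1, he2]
          field_simp
          ring
        _ ≤ _ := by gcongr
    · have hc0 : 0 ≤ 1 - Real.exp (-1) := by
        rw [sub_nonneg]
        exact Real.exp_le_one_iff.2 (by norm_num)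
      -- The splitting point is where the bound `e^(-1) + (s - x) / a (j + 2)` reaches 1.
      have hxy : x ≤ x + a (j + 2) * (1 - Real.exp (-1)) := by
        have := mul_nonneg hj2.le hc0
        linarith
      have hyt : x + a (j + 2) * (1 - Real.exp (-1)) ≤ t := by
        have h1 : a (j + 2) * (1 - Real.exp (-1)) ≤ t - x := by
          rw [htw, haj, he1]
          have h2 : r * (Real.exp 1 - 1) ≤ w := by
            nlinarith [Real.exp_one_lt_d9]
          have h3 : r * a (j + 1) * (1 - 1 / Real.exp 1) =
              a (j + 1) * (r * (Real.exp 1 - 1)) / Real.exp 1 := by field_simp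
          rw [h3]
          gcongr
        linarith
      have hI := integral_min_one_le_split hp.cont hxy hyt hslope
      have hq := split_profile_le_exp (w := w) hr0.le
      have htx : t - (x + a (j + 2) * (1 - Real.exp (-1))) =
        (t - x) - a (j + 2) * (1 - Real.exp (-1)) := by ring
      have hyx : x + a (j + 2) * (1 - Real.exp (-1)) - x = a (j + 2) * (1 - Real.exp (-1)) := by
        ring
      rw [htx, hyx] at hI
      calc _ ≤ r * Real.exp (-2) + (Real.exp (-1) * (a (j + 2) * (1 - Real.exp (-1))) +
            (a (j + 2) * (1 - Real.exp (-1))) ^ 2 / (2 * a (j + 2)) +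
            (t - x - a (j + 2) * (1 - Real.exp (-1)))) / a (j + 1) := by gcongr
        _ = Real.exp (-2) * (r + Real.exp 1 * w - r * (Real.exp 1 - 1) ^ 2 / 2) := by
          rw [htw, haj, he1, he2]
          field_simp
          ring
        _ ≤ _ := by gcongr
  · refine (hp.nextProfile_le_low ha hanti hη hji' hiL ht).trans ?_
    exact mul_le_of_le_one_left (Real.exp_pos _).le hr1

/-- The profile two levels below the top. -/
theorem isProfile_base {a : ℕ → ℝ} {n : ℕ} (hn : 1 ≤ n)
    (ha : ∀ l, 1 ≤ l → l ≤ n + 1 → 0 < a l) (hanti : a (n + 1) ≤ a n)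
    {η η' : ℝ} (hη0 : 0 ≤ η) (hη : η ≤ 1 / 50) (hη0' : 0 ≤ η')
    (hη' : η' ≤ a (n + 1) / a n * (1 / 100)) :
    IsProfile a (n + 1) (n - 1) (nextProfile η' (a n) fun t => η + t / a (n + 1)) := by
  have hb := ha n hn (by omega)
  have haL := ha (n + 1) (by omega) le_rfl
  have hn1 : n - 1 + 1 = n := by omega
  have hcont : Continuous fun t : ℝ => η + t / a (n + 1) := by fun_prop
  have hnn : ∀ t : ℝ, 0 ≤ t → 0 ≤ η + t / a (n + 1) := fun t ht => by positivity
  refine ⟨continuous_nextProfile hcont, fun t ht => nextProfile_nonneg hcont hb hη0' hnn ht,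
    fun s t hs hst => nextProfile_mono hcont hb hnn hs hst,
    fun s t _ hst => by rw [hn1]; exact nextProfile_slope hcont hb hst, ?_⟩
  intro i hi hiL t ht
  set r := a (n + 1) / a n with hr
  have hr0 : 0 < r := div_pos haL hb
  have hr1 : r ≤ 1 := (div_le_one hb).2 hanti
  have haj : a (n + 1) = r * a n := by rw [hr]; field_simp
  have hepos := Real.exp_pos 1
  have he_lo := Real.exp_one_gt_d9
  have he_hi := Real.exp_one_lt_d9
  have ht0 : 0 ≤ t := (levelPoint_nonneg fun l hl hl' => ha l (by omega) hl').trans ht.1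
  set y := t / a (n + 1) with hy
  have hy0 : 0 ≤ y := by positivity
  have hty : t = y * a (n + 1) := by rw [hy]; field_simp
  have hquad : nextProfile η' (a n) (fun t => η + t / a (n + 1)) t ≤
      r * (1 / 100 + y / 50 + y ^ 2 / 2) := by
    have hI := integral_min_one_le_quadratic (x := 0) (t := t) (c := η) hcont ht0
      (fun s _ => by rw [sub_zero])
    unfold nextProfile
    calc _ ≤ r * (1 / 100) + (1 / 50 * (t - 0) + (t - 0) ^ 2 / (2 * a (n + 1))) / a n := by
          have : η * (t - 0) ≤ 1 / 50 * (t - 0) := by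
            rw [sub_zero]; exact mul_le_mul_of_nonneg_right hη ht0
          gcongr
          linarith
      _ = _ := by
        rw [hty, haj]
        field_simp
        ring
  have hcase : i = n + 1 ∨ i = n := by omega
  have he2 : Real.exp (-2) = 1 / Real.exp 1 ^ 2 := by
    rw [Real.exp_neg, ← Real.exp_nat_mul]; norm_num
  have he3 : Real.exp (-3) = 1 / Real.exp 1 ^ 3 := by
    rw [Real.exp_neg, ← Real.exp_nat_mul]; norm_num
  have hcast : ((n - 1 : ℕ) : ℝ) = n - 1 := by push_cast [Nat.cast_sub hn]; ring
  rcases hcase with rfl | rfl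
  · rw [levelPoint_eq_add a le_rfl, levelPoint_top, zero_add] at ht
    have hlb : levelBound a (n + 1) (n - 1) (n + 1) t = Real.exp (-3) * Real.exp (Real.exp 1 * y) := by
      rw [levelBound, levelPoint_top, ← Real.exp_add, hcast, hy]
      congr 1
      push_cast
      ring
    rw [hlb]
    refine hquad.trans ?_
    have hy1 : Real.exp 1 * y ≤ 1 := by
      have := ht.2
      rw [hty, le_div_iff₀ hepos] at this
      have h2 : (Real.exp 1 * y) * a (n + 1) ≤ 1 * a (n + 1) := by linarith
      exact le_of_mul_le_mul_right h2 haL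
    set w := Real.exp 1 * y with hw
    have hyw : y = w / Real.exp 1 := by rw [hw]; field_simp
    have hw0 : 0 ≤ w := by positivity
    have hq : 1 + w + w ^ 2 / 2 ≤ Real.exp w := Real.quadratic_le_exp_of_nonneg hw0
    have hmain : Real.exp 1 ^ 3 * (1 / 100) + Real.exp 1 ^ 2 * (w / 50) +
        Real.exp 1 * (w ^ 2 / 2) ≤ Real.exp w := by
      have h2 : Real.exp 1 ^ 2 ≤ 7.4 := by nlinarith
      have h3 : Real.exp 1 ^ 3 ≤ 20.2 := by nlinarith
      nlinarith [sq_nonneg w, mul_nonneg hw0 (sub_nonneg.2 hy1)]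
    calc _ ≤ 1 * (1 / 100 + y / 50 + y ^ 2 / 2) := by gcongr
      _ = Real.exp (-3) * (Real.exp 1 ^ 3 * (1 / 100) + Real.exp 1 ^ 2 * (w / 50) +
        Real.exp 1 * (w ^ 2 / 2)) := by
          rw [hyw, he3]
          field_simp
      _ ≤ _ := by gcongr
  · have hx : levelPoint a (i + 1) (i + 1) = a (i + 1) / Real.exp 1 := by
      rw [levelPoint_eq_add a le_rfl, levelPoint_top, zero_add]
    have hlb : levelBound a (i + 1) (i - 1) i t =
        Real.exp (-2) * Real.exp (r * (Real.exp 1 * y - 1)) := by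
      rw [levelBound, hx, ← Real.exp_add, hcast, hty, haj]
      congr 1
      field_simp
      ring
    rw [hlb]
    have hye : 1 ≤ Real.exp 1 * y := by
      have := ht.1
      rw [hx, hty, div_le_iff₀ hepos] at this
      have h2 : 1 * a (i + 1) ≤ (Real.exp 1 * y) * a (i + 1) := by linarith
      exact le_of_mul_le_mul_right h2 haL
    have hE1 := Real.add_one_le_exp (r * (Real.exp 1 * y - 1))
    have hE2 := exp_one_mul_le_exp (r * (Real.exp 1 * y - 1))
    have hsuff : ∀ z, Real.exp 1 ^ 2 * z ≤ Real.exp (r * (Real.exp 1 * y - 1)) →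
        z ≤ Real.exp (-2) * Real.exp (r * (Real.exp 1 * y - 1)) := fun z hz => by
      rw [he2, div_mul_eq_mul_div, one_mul, le_div_iff₀ (by positivity)]
      linarith
    have hylo : 0.36 ≤ y := by
      by_contra! hlt
      have : Real.exp 1 * y ≤ 2.7182818286 * 0.36 := by gcongr
      linarith
    have hshift : ∀ z, z ≤ y - 0.3679 → Real.exp 1 * z ≤ Real.exp 1 * y - 1 := fun z hz =>
      (mul_le_mul_of_nonneg_left hz hepos.le).trans (by linarith)
    -- For `y ≤ 0.6` the exponential is bounded below by `1 + u ≤ e^u`, afterwards by `e u ≤ e^u`.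
    -- From `y = 1` on, the quadratic growth of the integral is replaced by the linear growth due to
    -- the cap.
    rcases le_total y 0.6 with hy6 | hy6
    · refine hquad.trans (hsuff _ ?_)
      have h0 : 1 / 100 + y / 50 + y ^ 2 / 2 ≤ 0.3678 * y := by
        have := mul_nonneg (sub_nonneg.2 hylo) (sub_nonneg.2 hy6)
        linarith
      have h1 : Real.exp 1 * (1 / 100 + y / 50 + y ^ 2 / 2) ≤ y :=
        calc _ ≤ 2.7182818286 * (0.3678 * y) := by gcongr
          _ ≤ y := by linarith
      have h2 : r * (Real.exp 1 * y) ≤ r * (Real.exp 1 * y - 1) + 1 := by linarith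
      calc _ = r * (Real.exp 1 * (Real.exp 1 * (1 / 100 + y / 50 + y ^ 2 / 2))) := by ring
        _ ≤ r * (Real.exp 1 * y) := by gcongr
        _ ≤ _ := by linarith
    · rcases le_total y 1 with hy1 | hy1
      · refine hquad.trans (hsuff _ ?_)
        have h0 : 1 / 100 + y / 50 + y ^ 2 / 2 ≤ y - 0.3679 := by
          have := mul_nonneg (sub_nonneg.2 hy6) (sub_nonneg.2 hy1)
          linarith
        have h1 := hshift _ h0
        calc _ = Real.exp 1 * (r * (Real.exp 1 * (1 / 100 + y / 50 + y ^ 2 / 2))) := by ring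
          _ ≤ Real.exp 1 * (r * (Real.exp 1 * y - 1)) := by gcongr
          _ ≤ _ := hE2
      · have hat : a (i + 1) ≤ t := by rw [hty]; exact le_mul_of_one_le_left haL.le hy1
        have hI := integral_min_one_le_split (x := 0) (t := t) (c := η) hcont haL.le hat
          (fun s _ => by rw [sub_zero])
        have hlin : nextProfile η' (a i) (fun t => η + t / a (i + 1)) t ≤
            r * (1 / 100 + 1 / 50 + 1 / 2 + (y - 1)) := by
          unfold nextProfile
          calc _ ≤ r * (1 / 100) + (1 / 50 * a (i + 1) + (a (i + 1)) ^ 2 / (2 * a (i + 1)) +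
                (t - a (i + 1))) / a i := by
                have : η * (a (i + 1) - 0) ≤ 1 / 50 * a (i + 1) := by
                  rw [sub_zero]; exact mul_le_mul_of_nonneg_right hη haL.le
                rw [sub_zero] at hI this
                gcongr
                linarith
            _ = _ := by
              rw [hty, haj]
              field_simp
              ring
        refine hlin.trans (hsuff _ ?_)
        have h1 := hshift (1 / 100 + 1 / 50 + 1 / 2 + (y - 1)) (by linarith)
        calc _ = Real.exp 1 * (r * (Real.exp 1 * (1 / 100 + 1 / 50 + 1 / 2 + (y - 1)))) := by ring
          _ ≤ Real.exp 1 * (r * (Real.exp 1 * y - 1)) := by gcongr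
          _ ≤ _ := hE2

/-! ### Chains of zeros from Rolle's theorem -/

theorem exists_interlacing_zeros {lo hi : ℝ} {φ φ' : ℝ → ℝ}
    (hφ : ∀ x ∈ Icc lo hi, HasDerivWithinAt φ (φ' x) (Icc lo hi) x) {m : ℕ} {z : ℕ → ℝ}
    (hz : ∀ i < m, z i < z (i + 1)) (hmem : ∀ i ≤ m, z i ∈ Icc lo hi)
    (h0 : ∀ i ≤ m, φ (z i) = 0) :
    ∃ z' : ℕ → ℝ, ∀ i < m, z i < z' i ∧ z' i < z (i + 1) ∧ φ' (z' i) = 0 := by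
  have key : ∀ i, ∃ c, i < m → z i < c ∧ c < z (i + 1) ∧ φ' c = 0 := by
    intro i
    by_cases him : i < m
    · have hsub : Icc (z i) (z (i + 1)) ⊆ Icc lo hi :=
        Icc_subset_Icc (hmem i him.le).1 (hmem (i + 1) him).2
      obtain ⟨c, hc, hc0⟩ := exists_hasDerivAt_eq_zero (hz i him)
        (fun x hx => ((hφ x (hsub hx)).mono hsub).continuousWithinAt)
        (by rw [h0 i him.le, h0 (i + 1) him])
        (fun x hx => (hφ x (hsub (Ioo_subset_Icc_self hx))).hasDerivAt
          (Icc_mem_nhds ((hmem i him.le).1.trans_lt hx.1) (hx.2.trans_le (hmem (i + 1) him).2)))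
      exact ⟨c, fun _ => ⟨hc.1, hc.2, hc0⟩⟩
    · exact ⟨0, fun h => absurd h him⟩
  choose z' hz' using key
  exact ⟨z', hz'⟩

/-- Rolle's theorem, iterated: the first and the last zeros of the successive derivatives. -/
theorem exists_monotone_zero_chains {lo hi : ℝ} {n : ℕ} {F : ℕ → ℝ → ℝ}
    (hF : ∀ j, ∀ x ∈ Icc lo hi, HasDerivWithinAt (F j) (F (j + 1) x) (Icc lo hi) x) {z : ℕ → ℝ}
    (hz : ∀ i < n, z i < z (i + 1)) (hmem : ∀ i ≤ n, z i ∈ Icc lo hi)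
    (h0 : ∀ i ≤ n, F 0 (z i) = 0) :
    ∃ ξ ξ' : ℕ → ℝ, ξ 0 = z 0 ∧ ξ' 0 = z n ∧ ξ n = ξ' n ∧
      (∀ j < n, ξ j ≤ ξ (j + 1)) ∧ (∀ j < n, ξ' (j + 1) ≤ ξ' j) ∧
      ∀ j ≤ n, F j (ξ j) = 0 ∧ F j (ξ' j) = 0 := by
  induction n generalizing F z with
  | zero =>
    refine ⟨z, z, rfl, rfl, rfl, by simp, by simp, fun j hj => ?_⟩
    obtain rfl : j = 0 := by omega
    exact ⟨h0 0 le_rfl, h0 0 le_rfl⟩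
  | succ n ih =>
    obtain ⟨z', hz'⟩ := exists_interlacing_zeros (hF 0) hz hmem h0
    obtain ⟨ξ, ξ', e0, e0', en, hm, hm', hzero⟩ := ih (F := fun j => F (j + 1)) (z := z')
      (fun j => hF (j + 1)) (fun i hi => (hz' i (by omega)).2.1.trans (hz' (i + 1) (by omega)).1)
      (fun i hi => ⟨(hmem i (by omega)).1.trans (hz' i (by omega)).1.le,
        (hz' i (by omega)).2.1.le.trans (hmem (i + 1) (by omega)).2⟩)
      (fun i hi => (hz' i (by omega)).2.2)
    refine ⟨fun j => Nat.casesOn j (z 0) ξ, fun j => Nat.casesOn j (z (n + 1)) ξ', rfl, rfl, en,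
      ?_, ?_, ?_⟩
    · rintro (_ | j) hj
      · exact (hz' 0 (by omega)).1.le.trans_eq e0.symm
      · exact hm j (by omega)
    · rintro (_ | j) hj
      · exact e0'.trans_le (hz' n (by omega)).2.1.le
      · exact hm' j (by omega)
    · rintro (_ | j) hj
      · exact ⟨h0 0 (by omega), h0 (n + 1) le_rfl⟩
      · exact hzero j (by omega)

theorem sum_abs_sub_of_monotone {n : ℕ} {ξ : ℕ → ℝ} (h : ∀ j < n, ξ j ≤ ξ (j + 1)) :
    ∑ i ∈ Finset.range n, |ξ i - ξ (i + 1)| = ξ n - ξ 0 := by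
  rw [← Finset.sum_range_sub]
  refine Finset.sum_congr rfl fun i hi => ?_
  rw [abs_sub_comm, abs_of_nonneg (sub_nonneg.2 (h i (Finset.mem_range.1 hi)))]

theorem sum_abs_sub_of_antitone {n : ℕ} {ξ : ℕ → ℝ} (h : ∀ j < n, ξ (j + 1) ≤ ξ j) :
    ∑ i ∈ Finset.range n, |ξ i - ξ (i + 1)| = ξ 0 - ξ n := by
  rw [← Finset.sum_range_sub']
  refine Finset.sum_congr rfl fun i hi => ?_
  rw [abs_of_nonneg (sub_nonneg.2 (h i (Finset.mem_range.1 hi)))]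

theorem monotone_chain_le {n : ℕ} {ξ : ℕ → ℝ} (h : ∀ j < n, ξ j ≤ ξ (j + 1)) {i j : ℕ}
    (hij : i ≤ j) (hj : j ≤ n) : ξ i ≤ ξ j := by
  induction j, hij using Nat.le_induction with
  | base => exact le_rfl
  | succ j _ ih => exact (ih (by omega)).trans (h j hj)

/-- A chain of zeros of the successive derivatives which, with the way from `x` to its first
point, is no longer than the convex hull of `x` and the zeros of the function. -/
theorem exists_short_zero_chain {lo hi : ℝ} {n : ℕ} {F : ℕ → ℝ → ℝ}
    (hF : ∀ j, ∀ x ∈ Icc lo hi, HasDerivWithinAt (F j) (F (j + 1) x) (Icc lo hi) x) {z : ℕ → ℝ}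
    (hz : ∀ i < n, z i < z (i + 1)) (hmem : ∀ i ≤ n, z i ∈ Icc lo hi)
    (h0 : ∀ i ≤ n, F 0 (z i) = 0) (x : ℝ) :
    ∃ ξ : ℕ → ℝ, (∀ j ≤ n, F j (ξ j) = 0 ∧ ξ j ∈ Icc (z 0) (z n)) ∧
      |x - ξ 0| + ∑ i ∈ Finset.range n, |ξ i - ξ (i + 1)| ≤ max x (z n) - min x (z 0) := by
  obtain ⟨ξ, ξ', e0, e0', en, hm, hm', hzero⟩ := exists_monotone_zero_chains hF hz hmem h0
  have hm'' : ∀ j < n, (fun i => -ξ' i) j ≤ (fun i => -ξ' i) (j + 1) := fun j hj =>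
    neg_le_neg (hm' j hj)
  have a1 : ∀ j ≤ n, ξ 0 ≤ ξ j ∧ ξ j ≤ ξ n := fun j hj =>
    ⟨monotone_chain_le hm (Nat.zero_le _) hj, monotone_chain_le hm hj le_rfl⟩
  have a2 : ∀ j ≤ n, ξ' j ≤ ξ' 0 ∧ ξ' n ≤ ξ' j := fun j hj =>
    ⟨neg_le_neg_iff.1 (monotone_chain_le hm'' (Nat.zero_le _) hj),
      neg_le_neg_iff.1 (monotone_chain_le hm'' hj le_rfl)⟩
  have b1 := a1 n le_rfl
  have b2 := a2 n le_rfl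
  have hs1 := sum_abs_sub_of_monotone hm
  have hs2 := sum_abs_sub_of_antitone hm'
  have c1 := le_max_left x (z n)
  have c2 := le_max_right x (z n)
  have c3 := min_le_left x (z 0)
  have c4 := min_le_right x (z 0)
  have hor : |x - ξ 0| + (ξ n - ξ 0) ≤ max x (z n) - min x (z 0) ∨
      |x - ξ' 0| + (ξ' 0 - ξ' n) ≤ max x (z n) - min x (z 0) := by
    rcases le_total x (ξ 0) with hx | hx
    · left
      rw [abs_of_nonpos (by linarith)]
      linarith
    · rcases le_total x (ξ' 0) with hx' | hx'
      · rw [abs_of_nonneg (by linarith), abs_of_nonpos (by linarith)]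
        -- For `x` between the extreme zeros the two total lengths add up to `2 (z n - z 0)`,
        -- because both chains end at the same point; so one of them is at most `z n - z 0`.
        by_contra! hcon
        linarith [hcon.1, hcon.2]
      · right
        rw [abs_of_nonneg (by linarith)]
        linarith
  rcases hor with h | h
  · refine ⟨ξ, fun j hj => ⟨(hzero j hj).1, ?_, ?_⟩, by rw [hs1]; exact h⟩
    · linarith [a1 j hj]
    · linarith [a1 j hj]
  · refine ⟨ξ', fun j hj => ⟨(hzero j hj).2, ?_, ?_⟩, by rw [hs2]; exact h⟩
    · linarith [a2 j hj]
    · linarith [a2 j hj]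

/-! ### Propagation of bounds along a chain -/

/-- Propagation of a bound for the derivative to one for the function, both in terms of the length
of the way to the end of a chain of points. -/
theorem abs_le_of_abs_deriv_le {lo hi : ℝ} {φ φ' : ℝ → ℝ}
    (hφ : ∀ x ∈ Icc lo hi, HasDerivWithinAt φ (φ' x) (Icc lo hi) x) {ξ ξ' T : ℝ}
    (hξ : ξ ∈ Icc lo hi) (hT : 0 ≤ T) {G B : ℝ → ℝ}
    (hG : ∀ y ∈ Icc lo hi, |φ' y| ≤ G (|y - ξ'| + T))
    (hGmono : ∀ s t, 0 ≤ s → s ≤ t → G s ≤ G t) (hB : ∀ t, HasDerivAt B (G t) t)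
    (hstart : |φ ξ| ≤ B (|ξ - ξ'| + T)) :
    ∀ y ∈ Icc lo hi, |φ y| ≤ B (|y - ξ| + (|ξ - ξ'| + T)) := by
  intro y hy
  set c : ℝ → ℝ := fun s => ξ + s * (y - ξ) with hc
  have hcd : ∀ s, HasDerivAt c (y - ξ) s := fun s => by
    exact (((hasDerivAt_id s).mul_const (y - ξ)).const_add ξ).congr_deriv (one_mul _)
  have hmaps : MapsTo c (Icc 0 1) (Icc lo hi) := by
    intro s hs
    have := (convex_Icc lo hi) hξ hy (sub_nonneg.2 hs.2) hs.1 (by ring)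
    simp only [smul_eq_mul] at this
    convert this using 1
    simp only [hc]
    ring
  have hu : ∀ s ∈ Icc (0 : ℝ) 1,
      HasDerivWithinAt (fun s => φ (c s)) (φ' (c s) * (y - ξ)) (Icc 0 1) s := fun s hs =>
    (hφ (c s) (hmaps hs)).comp s (hcd s).hasDerivWithinAt hmaps
  have hBd : ∀ s, HasDerivAt (fun s => B (s * |y - ξ| + (|ξ - ξ'| + T)))
      (G (s * |y - ξ| + (|ξ - ξ'| + T)) * |y - ξ|) s := fun s => by
    have h1 : HasDerivAt (fun s : ℝ => s * |y - ξ| + (|ξ - ξ'| + T)) |y - ξ| s := by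
      simpa using ((hasDerivAt_id s).mul_const |y - ξ|).add_const (|ξ - ξ'| + T)
    exact (hB _).comp s h1
  have key := image_norm_le_of_norm_deriv_right_le_deriv_boundary' (a := 0) (b := 1)
    (f := fun s => φ (c s)) (f' := fun s => φ' (c s) * (y - ξ))
    (B := fun s => B (s * |y - ξ| + (|ξ - ξ'| + T)))
    (B' := fun s => G (s * |y - ξ| + (|ξ - ξ'| + T)) * |y - ξ|)
    (fun s hs => (hu s hs).continuousWithinAt)
    (fun s hs => (hu s (Ico_subset_Icc_self hs)).mono_of_mem_nhdsWithin (Icc_mem_nhdsGE_of_mem hs))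
    (by simpa [hc] using hstart)
    (fun s _ => (hBd s).continuousAt.continuousWithinAt)
    (fun s _ => (hBd s).hasDerivWithinAt)
    (fun s hs => by
      rw [Real.norm_eq_abs, abs_mul]
      refine mul_le_mul_of_nonneg_right ?_ (abs_nonneg _)
      refine (hG (c s) (hmaps (Ico_subset_Icc_self hs))).trans (hGmono _ _ (by positivity) ?_)
      have h1 : |c s - ξ'| ≤ s * |y - ξ| + |ξ - ξ'| := by
        have : c s - ξ' = s * (y - ξ) + (ξ - ξ') := by simp only [hc]; ring
        rw [this]
        refine (abs_add_le _ _).trans ?_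
        rw [abs_mul, abs_of_nonneg hs.1]
      linarith)
  have := key (right_mem_Icc.2 zero_le_one)
  simpa [hc] using this

/-- The length of a chain from its `j`-th to its `n`-th point. -/
noncomputable def chainLength (ξ : ℕ → ℝ) (n j : ℕ) : ℝ :=
  ∑ i ∈ Finset.Ico j n, |ξ i - ξ (i + 1)|

theorem chainLength_self (ξ : ℕ → ℝ) (n : ℕ) : chainLength ξ n n = 0 := by
  simp [chainLength]

theorem chainLength_eq_add (ξ : ℕ → ℝ) {n j : ℕ} (hj : j < n) :
    chainLength ξ n j = |ξ j - ξ (j + 1)| + chainLength ξ n (j + 1) := by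
  rw [chainLength, Finset.sum_eq_sum_Ico_succ_bot hj, chainLength]

theorem chainLength_nonneg (ξ : ℕ → ℝ) (n j : ℕ) : 0 ≤ chainLength ξ n j :=
  Finset.sum_nonneg fun _ _ => abs_nonneg _

theorem chainLength_zero (ξ : ℕ → ℝ) (n : ℕ) :
    chainLength ξ n 0 = ∑ i ∈ Finset.range n, |ξ i - ξ (i + 1)| := by
  rw [chainLength, Finset.range_eq_Ico]

/-- The Abel-Gontcharoff remainder estimate. -/
theorem abs_le_pow_div_factorial_of_zero_chain {lo hi : ℝ} {n : ℕ} {F : ℕ → ℝ → ℝ}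
    (hF : ∀ j, ∀ x ∈ Icc lo hi, HasDerivWithinAt (F j) (F (j + 1) x) (Icc lo hi) x) {ξ : ℕ → ℝ}
    (hξ : ∀ j ≤ n, F j (ξ j) = 0 ∧ ξ j ∈ Icc lo hi) {C : ℝ} (hC : 0 ≤ C)
    (hbd : ∀ y ∈ Icc lo hi, |F (n + 1) y| ≤ C) {j : ℕ} (hj : j ≤ n) :
    ∀ y ∈ Icc lo hi, |F j y| ≤
      C * (|y - ξ j| + chainLength ξ n j) ^ (n + 1 - j) / (n + 1 - j).factorial := by
  have hpow : ∀ m : ℕ, ∀ t : ℝ, HasDerivAt (fun t : ℝ => C * t ^ (m + 1) / (m + 1).factorial)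
      (C * t ^ m / m.factorial) t := fun m t => by
    refine (((hasDerivAt_pow (m + 1) t).const_mul C).div_const _).congr_deriv ?_
    rw [Nat.factorial_succ]
    have : (m.factorial : ℝ) ≠ 0 := by exact_mod_cast m.factorial_ne_zero
    push_cast
    field_simp
  have hmono : ∀ m : ℕ, ∀ s t : ℝ, 0 ≤ s → s ≤ t →
      C * s ^ m / m.factorial ≤ C * t ^ m / m.factorial := fun m s t hs hst => by gcongr
  induction hj using Nat.decreasingInduction with
  | self =>
    have h1 : n + 1 - n = 0 + 1 := by omega
    rw [h1, chainLength_self]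
    have := abs_le_of_abs_deriv_le (hF n) (ξ' := ξ n) (T := 0) (hξ n le_rfl).2 le_rfl
      (G := fun t => C * t ^ 0 / (0).factorial) (fun y hy => by simpa using hbd y hy) (hmono 0)
      (hpow 0) (by simp [(hξ n le_rfl).1])
    simpa using this
  | of_succ j hj ih =>
    have h1 : n + 1 - j = (n + 1 - (j + 1)) + 1 := by omega
    rw [h1, chainLength_eq_add ξ hj]
    refine abs_le_of_abs_deriv_le (hF j) (hξ j hj.le).2 (chainLength_nonneg _ _ _)
      ih (hmono _) (hpow _) ?_
    rw [(hξ j hj.le).1, abs_zero]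
    have := chainLength_nonneg ξ n (j + 1)
    positivity

/-! ### Bang's theorem with small values in place of zeros -/

theorem hasDerivAt_nextProfile {η b : ℝ} {h : ℝ → ℝ} (hh : Continuous h) (t : ℝ) :
    HasDerivAt (nextProfile η b h) (min 1 (h t) / b) t := by
  have hg : Continuous (fun s => min 1 (h s)) := continuous_const.min hh
  exact ((hg.integral_hasStrictDerivAt 0 t).hasDerivAt.div_const b).const_add η

theorem nextProfile_zero (η b : ℝ) (h : ℝ → ℝ) : nextProfile η b h 0 = η := by
  simp [nextProfile]

/-- The derivative has the two majorants `m'` and `m' * h`, hence `m' * min 1 h`; `nextProfile` is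
its normalized primitive with starting value `η`. -/
theorem abs_le_nextProfile {lo hi : ℝ} {φ φ' : ℝ → ℝ}
    (hφ : ∀ x ∈ Icc lo hi, HasDerivWithinAt φ (φ' x) (Icc lo hi) x) {ξ ξ' T : ℝ}
    (hξ : ξ ∈ Icc lo hi) (hT : 0 ≤ T) {m m' b η : ℝ} (hb : 0 < b) (hm' : 0 ≤ m') (hm : m' * b = m)
    {h : ℝ → ℝ} (hcont : Continuous h) (hnn : ∀ t, 0 ≤ t → 0 ≤ h t)
    (hmono : ∀ s t, 0 ≤ s → s ≤ t → h s ≤ h t)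
    (hcap : ∀ y ∈ Icc lo hi, |φ' y| ≤ m')
    (hbd : ∀ y ∈ Icc lo hi, |φ' y| ≤ m' * h (|y - ξ'| + T)) (hstart : |φ ξ| ≤ η * m) :
    ∀ y ∈ Icc lo hi, |φ y| ≤ m * nextProfile η b h (|y - ξ| + (|ξ - ξ'| + T)) := by
  subst hm
  refine abs_le_of_abs_deriv_le (ξ' := ξ') (G := fun t => m' * min 1 (h t))
    (B := fun t => m' * b * nextProfile η b h t) hφ hξ hT (fun y hy => ?_)
    (fun s t hs hst => ?_) (fun t => ?_) (hstart.trans ?_)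
  · rw [mul_min_of_nonneg _ _ hm', mul_one]
    exact le_min (hcap y hy) (hbd y hy)
  · have := hmono s t hs hst
    gcongr
  · refine ((hasDerivAt_nextProfile hcont t).const_mul (m' * b)).congr_deriv ?_
    field_simp
  · rw [mul_comm η]
    refine mul_le_mul_of_nonneg_left ?_ (mul_nonneg hm' hb.le)
    have := nextProfile_mono (η := η) hcont hb hnn le_rfl (add_nonneg (abs_nonneg (ξ - ξ')) hT)
    rwa [nextProfile_zero] at this

/-- A robust form of Bang's theorem: if the successive derivatives are small at the points of a
chain, then the function is small near the chain. -/
theorem exists_profile_of_small_chain {lo hi : ℝ} {n : ℕ} (hn : 1 ≤ n) {F : ℕ → ℝ → ℝ}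
    (hF : ∀ j, ∀ x ∈ Icc lo hi, HasDerivWithinAt (F j) (F (j + 1) x) (Icc lo hi) x)
    {m a η ξ : ℕ → ℝ} (ha : ∀ l, 1 ≤ l → l ≤ n + 1 → 0 < a l)
    (hanti : ∀ l, 1 ≤ l → l < n + 1 → a (l + 1) ≤ a l)
    (hm : ∀ j ≤ n + 1, 0 ≤ m j) (hma : ∀ j ≤ n, m (j + 1) * a (j + 1) = m j)
    (hcap : ∀ j ≤ n + 1, ∀ y ∈ Icc lo hi, |F j y| ≤ m j)
    (hξ : ∀ j ≤ n, ξ j ∈ Icc lo hi) (hsmall : ∀ j ≤ n, |F j (ξ j)| ≤ η j * m j)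
    (hη0 : ∀ j ≤ n, 0 ≤ η j) (hηn : η n ≤ 1 / 50)
    (hη : ∀ j < n, η j ≤ a (j + 2) / a (j + 1) * Real.exp ((j : ℝ) - n - 4))
    {j : ℕ} (hj : j ≤ n - 1) :
    ∃ h, IsProfile a (n + 1) j h ∧
      ∀ y ∈ Icc lo hi, |F j y| ≤ m j * h (|y - ξ j| + chainLength ξ n j) := by
  induction hj using Nat.decreasingInduction with
  -- The induction starts at `n - 1`: for index `n`, the linear majorant `η n + t / a (n + 1)` meets
  -- the level bound `e^(-1)` at `x_(n+1)` already when `η n = 0`, which leaves no room for a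
  -- positive `η n`.
  | self =>
    have haL := ha (n + 1) (by omega) le_rfl
    have hn1 : n - 1 + 1 = n := by omega
    have htop : ∀ y ∈ Icc lo hi, |F n y| ≤ m n * (η n + (|y - ξ n| + chainLength ξ n n) / a (n + 1)) := by
      rw [chainLength_self]
      have := abs_le_of_abs_deriv_le (hF n) (ξ' := ξ n) (T := 0) (hξ n le_rfl) le_rfl
        (G := fun _ => m (n + 1)) (B := fun t => m n * (η n + t / a (n + 1)))
        (hcap (n + 1) le_rfl) (fun _ _ _ _ => le_rfl) (fun t => by
          refine ((((hasDerivAt_id t).div_const (a (n + 1))).const_add (η n)).const_mul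
            (m n)).congr_deriv ?_
          rw [← hma n le_rfl]
          field_simp) (by simpa [mul_comm] using hsmall n le_rfl)
      simpa using this
    have he5 : Real.exp (((n - 1 : ℕ) : ℝ) - n - 4) ≤ 1 / 100 := by
      have : ((n - 1 : ℕ) : ℝ) - n - 4 = -5 := by push_cast [Nat.cast_sub hn]; ring
      rw [this, Real.exp_neg, ← one_div]
      apply one_div_le_one_div_of_le (by norm_num)
      have h5 : Real.exp 5 = Real.exp 1 ^ 5 := by rw [← Real.exp_nat_mul]; norm_num
      rw [h5]
      calc (100 : ℝ) ≤ 2.7 ^ 5 := by norm_num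
        _ ≤ _ := by gcongr; linarith [Real.exp_one_gt_d9]
    have hηn1 : η (n - 1) ≤ a (n + 1) / a n * (1 / 100) := by
      have h := hη (n - 1) (by omega)
      rw [show n - 1 + 2 = n + 1 by omega, hn1] at h
      refine h.trans (mul_le_mul_of_nonneg_left he5 ?_)
      exact div_nonneg haL.le (ha n hn (by omega)).le
    refine ⟨nextProfile (η (n - 1)) (a n) fun t => η n + t / a (n + 1),
      isProfile_base hn ha (hanti n hn (by omega)) (hη0 n le_rfl) hηn (hη0 _ (by omega)) hηn1, ?_⟩
    have hη00 := hη0 n le_rfl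
    have := abs_le_nextProfile (η := η (n - 1)) (m := m (n - 1)) (hF (n - 1))
      (hξ (n - 1) (by omega)) (chainLength_nonneg ξ n (n - 1 + 1))
      (ha (n - 1 + 1) (by omega) (by omega)) (hm (n - 1 + 1) (by omega)) (hma (n - 1) (by omega))
      (h := fun t => η n + t / a (n + 1)) (by fun_prop) (fun t ht => by positivity)
      (fun s t _ hst => by gcongr) (hcap (n - 1 + 1) (by omega))
      (by rw [hn1]; exact htop) (hsmall (n - 1) (by omega))
    rw [hn1] at this
    rw [chainLength_eq_add ξ (show n - 1 < n by omega), hn1]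
    exact this
  | of_succ j hj ih =>
    obtain ⟨h, hp, hb⟩ := ih
    refine ⟨nextProfile (η j) (a (j + 1)) h, hp.next (by omega) ha (fun l h1 h2 => hanti l h1 h2)
      (hη0 j (by omega)) ((hη j (by omega)).trans ?_), ?_⟩
    · refine mul_le_mul_of_nonneg_left (Real.exp_le_exp.2 ?_)
        (div_nonneg (ha _ (by omega) (by omega)).le (ha _ (by omega) (by omega)).le)
      push_cast
      linarith
    · rw [chainLength_eq_add ξ (show j < n by omega)]
      exact abs_le_nextProfile (hF j) (hξ j (by omega)) (chainLength_nonneg ξ n (j + 1))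
        (ha (j + 1) (by omega) (by omega)) (hm (j + 1) (by omega)) (hma j (by omega))
        hp.cont hp.nonneg hp.mono (hcap (j + 1) (by omega)) hb (hsmall j (by omega))

theorem levelPoint_antitone {a : ℕ → ℝ} {L : ℕ} (ha : ∀ l, 1 ≤ l → l ≤ L → 0 < a l) {i j : ℕ}
    (hi : 1 ≤ i) (hij : i ≤ j) : levelPoint a L j ≤ levelPoint a L i := by
  unfold levelPoint
  refine div_le_div_of_nonneg_right ?_ (Real.exp_pos 1).le
  refine Finset.sum_le_sum_of_subset_of_nonneg (Finset.Ico_subset_Ico_left hij) ?_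
  intro l hl _
  rw [Finset.mem_Ico] at hl
  exact (ha l (by omega) (by omega)).le

/-- The profile of index 0 is increasing and at most `e^(-k)` at the right end `x_k` of level `k`.
-/
theorem abs_le_exp_neg_of_small_chain {lo hi : ℝ} {n : ℕ} (hn : 1 ≤ n) {F : ℕ → ℝ → ℝ}
    (hF : ∀ j, ∀ x ∈ Icc lo hi, HasDerivWithinAt (F j) (F (j + 1) x) (Icc lo hi) x)
    {m a η ξ : ℕ → ℝ} (ha : ∀ l, 1 ≤ l → l ≤ n + 1 → 0 < a l)
    (hanti : ∀ l, 1 ≤ l → l < n + 1 → a (l + 1) ≤ a l)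
    (hm : ∀ j ≤ n + 1, 0 ≤ m j) (hma : ∀ j ≤ n, m (j + 1) * a (j + 1) = m j)
    (hcap : ∀ j ≤ n + 1, ∀ y ∈ Icc lo hi, |F j y| ≤ m j)
    (hξ : ∀ j ≤ n, ξ j ∈ Icc lo hi) (hsmall : ∀ j ≤ n, |F j (ξ j)| ≤ η j * m j)
    (hη0 : ∀ j ≤ n, 0 ≤ η j) (hηn : η n ≤ 1 / 50)
    (hη : ∀ j < n, η j ≤ a (j + 2) / a (j + 1) * Real.exp ((j : ℝ) - n - 4))
    {k : ℕ} (hk : 1 ≤ k) (hkn : k ≤ n + 1) {y : ℝ} (hy : y ∈ Icc lo hi)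
    (hlen : |y - ξ 0| + chainLength ξ n 0 ≤ levelPoint a (n + 1) k) :
    |F 0 y| ≤ m 0 * Real.exp (-k) := by
  obtain ⟨h, hp, hb⟩ := exists_profile_of_small_chain hn hF ha hanti hm hma hcap hξ hsmall hη0 hηn
    hη (Nat.zero_le _)
  refine (hb y hy).trans (mul_le_mul_of_nonneg_left ?_ (hm 0 (by omega)))
  refine (hp.mono _ _ (add_nonneg (abs_nonneg _) (chainLength_nonneg _ _ _)) hlen).trans ?_
  have h1 := hp.bound k hk hkn (levelPoint a (n + 1) k)
    ⟨levelPoint_antitone ha hk (Nat.le_succ k), le_rfl⟩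
  rw [levelBound_right hkn (ha k hk hkn)] at h1
  simpa using h1

/-! ### Separated nodes and Lagrange interpolation -/

/-- Greedy choice: take `y` in `E` within `ε` of the infimum and discard the points below `y + d`.
This loses measure at most `d + ε`, and `ε` is paid by the strict inequality in the hypothesis.
Subadditivity of the outer measure suffices. -/
theorem exists_separated_points {d : ℝ} (hd : 0 ≤ d) {k : ℕ} {E : Set ℝ} (hb : BddBelow E)
    (hE : ENNReal.ofReal (k * d) < volume E) :
    ∃ z : ℕ → ℝ, (∀ i ≤ k, z i ∈ E) ∧ ∀ i < k, z i + d ≤ z (i + 1) := by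
  induction k generalizing E with
  | zero =>
    have hne : E.Nonempty := by
      by_contra h
      rw [not_nonempty_iff_eq_empty] at h
      simp [h] at hE
    obtain ⟨x, hx⟩ := hne
    exact ⟨fun _ => x, fun _ _ => hx, by simp⟩
  | succ k ih =>
    have hne : E.Nonempty := by
      by_contra h
      rw [not_nonempty_iff_eq_empty] at h
      simp [h] at hE
    obtain ⟨c, hc1, hc2⟩ := ENNReal.lt_iff_exists_real_btwn.1 hE |>.imp fun c hc => hc.2
    have hkd : ((k + 1 : ℕ) : ℝ) * d < c := by
      by_contra! hcon
      exact absurd (hc1.trans_le (ENNReal.ofReal_le_ofReal hcon)) (lt_irrefl _)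
    have hkd0 : 0 ≤ (k : ℝ) * d := by positivity
    push_cast at hkd
    set ε := c - (k + 1) * d with hε
    have hε0 : 0 < ε := by rw [hε]; linarith
    obtain ⟨y, hyE, hy⟩ := Real.lt_sInf_add_pos hne hε0
    have hsub : E ⊆ (E ∩ Ici (y + d)) ∪ Icc (sInf E) (y + d) := fun x hx => by
      rcases le_total (y + d) x with h | h
      · exact Or.inl ⟨hx, h⟩
      · exact Or.inr ⟨csInf_le hb hx, h⟩
    have hvol : volume E ≤ volume (E ∩ Ici (y + d)) + ENNReal.ofReal (y + d - sInf E) := by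
      rw [← Real.volume_Icc]
      exact (measure_mono hsub).trans (measure_union_le _ _)
    have hlt : ENNReal.ofReal (k * d) < volume (E ∩ Ici (y + d)) := by
      by_contra! hcon
      have h1 := hc2.trans_le (hvol.trans (add_le_add_left hcon _))
      have hys : sInf E ≤ y := csInf_le hb hyE
      rw [← ENNReal.ofReal_add hkd0 (by linarith)] at h1
      have h2 := (ENNReal.ofReal_lt_ofReal_iff_of_nonneg (by linarith)).1 h1
      linarith
    obtain ⟨z, hz, hz'⟩ := ih (hb.mono inter_subset_left) hlt
    refine ⟨fun i => Nat.casesOn i y z, ?_, ?_⟩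
    · rintro (_ | i) hi
      · exact hyE
      · exact (hz i (by omega)).1
    · rintro (_ | i) hi
      · exact (hz 0 (Nat.zero_le _)).2
      · exact hz' i (by omega)

theorem add_mul_le_of_separated {d : ℝ} {n : ℕ} {z : ℕ → ℝ} (hz : ∀ i < n, z i + d ≤ z (i + 1))
    {i j : ℕ} (hij : i ≤ j) (hj : j ≤ n) : z i + ((j : ℝ) - i) * d ≤ z j := by
  induction j, hij using Nat.le_induction with
  | base => simp
  | succ j _ ih =>
    have h1 := ih (by omega)
    have h2 := hz j (by omega)
    push_cast
    linarith

theorem injOn_of_separated {d : ℝ} {n : ℕ} {z : ℕ → ℝ} (hd : 0 < d) (hz : ∀ i < n, z i + d ≤ z (i + 1)) :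
    Set.InjOn z (Finset.range (n + 1)) := by
  have key : ∀ i j, i < j → j ≤ n → z i < z j := fun i j hij hj => by
    have h1 := add_mul_le_of_separated hz hij.le hj
    have h2 : (0 : ℝ) < (j : ℝ) - i := by
      rw [sub_pos]; exact_mod_cast hij
    have := mul_pos h2 hd
    linarith
  intro i hi k hk hik
  simp only [Finset.coe_range, mem_Iio] at hi hk
  rcases lt_trichotomy i k with h | h | h
  · exact absurd hik (key i k h (by omega)).ne
  · exact h
  · exact absurd hik (key k i h (by omega)).ne'

theorem prod_range_sub_eq_factorial (i : ℕ) :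
    ∏ k ∈ Finset.range i, ((i : ℝ) - k) = i.factorial := by
  rw [← Nat.descFactorial_self, Nat.descFactorial_eq_prod_range]
  push_cast
  refine Finset.prod_congr rfl fun k hk => ?_
  rw [Nat.cast_sub (Finset.mem_range.1 hk).le]

theorem prod_Ico_sub_eq_factorial {i n : ℕ} (hi : i ≤ n) :
    ∏ k ∈ Finset.Ico (i + 1) (n + 1), ((k : ℝ) - i) = (n - i).factorial := by
  rw [Finset.prod_Ico_eq_prod_range, show n + 1 - (i + 1) = n - i by omega,
    ← Finset.prod_range_add_one_eq_factorial]
  push_cast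
  refine Finset.prod_congr rfl fun k _ => ?_
  ring

/-- Since `|z i - z k| ≥ |i - k| d`, the product is at least the one for equidistant nodes. -/
theorem le_prod_abs_sub_of_separated {d : ℝ} (hd : 0 ≤ d) {n : ℕ} {z : ℕ → ℝ}
    (hz : ∀ i < n, z i + d ≤ z (i + 1)) {i : ℕ} (hi : i ≤ n) :
    d ^ n * (i.factorial * (n - i).factorial) ≤
      ∏ k ∈ (Finset.range (n + 1)).erase i, |z i - z k| := by
  have hsplit : (Finset.range (n + 1)).erase i = Finset.range i ∪ Finset.Ico (i + 1) (n + 1) := by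
    ext k
    simp only [Finset.mem_erase, Finset.mem_range, Finset.mem_union, Finset.mem_Ico]
    omega
  have hdisj : Disjoint (Finset.range i) (Finset.Ico (i + 1) (n + 1)) := by
    rw [Finset.disjoint_left]
    intro k hk hk'
    rw [Finset.mem_range] at hk
    rw [Finset.mem_Ico] at hk'
    omega
  rw [hsplit, Finset.prod_union hdisj]
  have h1 : d ^ i * i.factorial ≤ ∏ k ∈ Finset.range i, |z i - z k| := by
    rw [← prod_range_sub_eq_factorial]
    have : d ^ i * ∏ k ∈ Finset.range i, ((i : ℝ) - k) =
        ∏ k ∈ Finset.range i, d * ((i : ℝ) - k) := by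
      rw [Finset.prod_mul_distrib, Finset.prod_const, Finset.card_range]
    rw [this]
    refine Finset.prod_le_prod (fun k hk => ?_) fun k hk => ?_
    · have : (k : ℝ) ≤ i := by exact_mod_cast (Finset.mem_range.1 hk).le
      exact mul_nonneg hd (by linarith)
    · have := add_mul_le_of_separated hz (Finset.mem_range.1 hk).le hi
      exact le_trans (by linarith) (le_abs_self _)
  have h2 : d ^ (n - i) * (n - i).factorial ≤
      ∏ k ∈ Finset.Ico (i + 1) (n + 1), |z i - z k| := by
    rw [← prod_Ico_sub_eq_factorial hi]
    have : d ^ (n - i) * ∏ k ∈ Finset.Ico (i + 1) (n + 1), ((k : ℝ) - i) =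
        ∏ k ∈ Finset.Ico (i + 1) (n + 1), d * ((k : ℝ) - i) := by
      rw [Finset.prod_mul_distrib, Finset.prod_const, Nat.card_Ico,
        show n + 1 - (i + 1) = n - i by omega]
    rw [this]
    refine Finset.prod_le_prod (fun k hk => ?_) fun k hk => ?_
    · have : (i : ℝ) ≤ k := by
        rw [Finset.mem_Ico] at hk
        exact_mod_cast (show i ≤ k by omega)
      exact mul_nonneg hd (by linarith)
    · rw [Finset.mem_Ico] at hk
      have := add_mul_le_of_separated hz (show i ≤ k by omega) (by omega)
      rw [abs_sub_comm]
      exact le_trans (by linarith) (le_abs_self _)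
  calc _ = (d ^ i * i.factorial) * (d ^ (n - i) * (n - i).factorial) := by
        rw [← Nat.add_sub_cancel' hi, pow_add]
        simp only [Nat.add_sub_cancel' hi]
        ring
    _ ≤ _ := by gcongr

open Polynomial in
/-- The derivatives of an interpolation polynomial with separated nodes. -/
theorem abs_eval_iterate_derivative_interpolate_le {d : ℝ} (hd : 0 < d) {n : ℕ} {z : ℕ → ℝ}
    (hz : ∀ i < n, z i + d ≤ z (i + 1)) {r : ℕ → ℝ} {δ : ℝ} (hr : ∀ i ≤ n, |r i| ≤ δ)
    {x X : ℝ} (hX : ∀ i ≤ n, |x - z i| ≤ X) {j : ℕ} (hj : j ≤ n) :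
    |(derivative^[j] (Lagrange.interpolate (Finset.range (n + 1)) z r)).eval x| ≤
      δ * (2 / d) ^ n * X ^ (n - j) / (n - j).factorial := by
  have hX0 : 0 ≤ X := (abs_nonneg _).trans (hX 0 (Nat.zero_le _))
  have hδ0 : 0 ≤ δ := (abs_nonneg _).trans (hr 0 (Nat.zero_le _))
  have hinj := injOn_of_separated hd hz
  rw [Lagrange.iterate_derivative_interpolate r hinj (by rw [Finset.card_range]; omega)]
  simp only [eval_mul, eval_natCast, eval_finsetSum, eval_C, eval_prod, eval_sub, eval_X,
    Finset.card_range]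
  rw [abs_mul, Nat.abs_cast]
  have hterm : ∀ i ∈ Finset.range (n + 1),
      |(r i / ∏ k ∈ (Finset.range (n + 1)).erase i, (z i - z k)) *
        ∑ t ∈ ((Finset.range (n + 1)).erase i).powersetCard (n + 1 - (j + 1)),
          ∏ a ∈ t, (x - z a)| ≤
      δ * (1 / d) ^ n * (n.choose j) * X ^ (n - j) / n.factorial * n.choose i := by
    intro i hi
    have hin : i ≤ n := by rw [Finset.mem_range] at hi; omega
    rw [abs_mul, abs_div, Finset.abs_prod]
    -- There are `n.choose j` subsets of size `n - j` of the `n` remaining nodes.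
    have h1 : |∑ t ∈ ((Finset.range (n + 1)).erase i).powersetCard (n + 1 - (j + 1)),
          ∏ a ∈ t, (x - z a)| ≤ n.choose j * X ^ (n - j) := by
      refine (Finset.abs_sum_le_sum_abs _ _).trans ?_
      have hb : ∀ t ∈ ((Finset.range (n + 1)).erase i).powersetCard (n + 1 - (j + 1)),
          |∏ a ∈ t, (x - z a)| ≤ X ^ (n - j) := by
        intro t ht
        rw [Finset.mem_powersetCard] at ht
        rw [Finset.abs_prod]
        refine (Finset.prod_le_prod (fun _ _ => abs_nonneg _) (fun a ha => hX a ?_)).trans_eq ?_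
        · have := Finset.mem_of_mem_erase (ht.1 ha)
          rw [Finset.mem_range] at this
          omega
        · rw [Finset.prod_const, ht.2]
          congr 1
          omega
      refine (Finset.sum_le_sum hb).trans_eq ?_
      rw [Finset.sum_const, Finset.card_powersetCard, Finset.card_erase_of_mem hi,
        Finset.card_range, nsmul_eq_mul, show n + 1 - 1 = n by omega,
        show n + 1 - (j + 1) = n - j by omega, Nat.choose_symm hj]
    have h2 := le_prod_abs_sub_of_separated hd.le hz hin
    have h3 : (n.choose i : ℝ) * (i.factorial * (n - i).factorial) = n.factorial := by
      rw [← mul_assoc]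
      exact_mod_cast Nat.choose_mul_factorial_mul_factorial hin
    have hf1 : (0 : ℝ) < i.factorial * (n - i).factorial := by positivity
    have hf2 : (0 : ℝ) < n.factorial := by positivity
    calc _ ≤ δ / (d ^ n * (i.factorial * (n - i).factorial)) * (n.choose j * X ^ (n - j)) := by
          gcongr
          exact hr i hin
      _ = _ := by
        rw [← h3, one_div, inv_pow]
        have : (n.choose i : ℝ) ≠ 0 := by
          exact_mod_cast (Nat.choose_pos hin).ne'
        field_simp
  -- The reciprocals of `i! (n - i)!` are binomial coefficients over `n!`; their sum produces the
  -- factor `2^n`.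
  have hsum : ∑ i ∈ Finset.range (n + 1), (n.choose i : ℝ) = 2 ^ n := by
    exact_mod_cast Nat.sum_range_choose n
  have hfac : (j.factorial : ℝ) * (n.choose j) * (n - j).factorial = n.factorial := by
    rw [mul_comm (j.factorial : ℝ)]
    exact_mod_cast Nat.choose_mul_factorial_mul_factorial hj
  calc _ ≤ (j.factorial : ℝ) * ∑ i ∈ Finset.range (n + 1),
        δ * (1 / d) ^ n * (n.choose j) * X ^ (n - j) / n.factorial * n.choose i := by
        gcongr
        exact (Finset.abs_sum_le_sum_abs _ _).trans (Finset.sum_le_sum hterm)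
    _ = _ := by
      rw [← Finset.mul_sum, hsum, ← hfac, div_pow, div_pow, one_pow]
      have h1 : (j.factorial : ℝ) ≠ 0 := by positivity
      have h2 : ((n - j).factorial : ℝ) ≠ 0 := by positivity
      have h3 : (n.choose j : ℝ) ≠ 0 := by exact_mod_cast (Nat.choose_pos hj).ne'
      field_simp

namespace DenjoyCarleman

/-! ### Power growth of `A` -/

theorem hasDerivWithinAt_derivA {A : ℝ → ℝ} (hA : ContDiffOn ℝ 1 A (Ici 1) ∨ IsPiecewiseLinear A)
    {s : ℝ} (hs : 1 < s) : HasDerivWithinAt A (derivA A s) (Iic s) s := by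
  rw [derivA, if_neg hs.ne']
  apply DifferentiableWithinAt.hasDerivWithinAt
  rcases hA with hA | ⟨t, ht0, htm, htt, hlin⟩
  · exact (((hA.differentiableOn one_ne_zero) s hs.le).differentiableAt
      (Ici_mem_nhds hs)).differentiableWithinAt
  · obtain ⟨i, hi1, hi2⟩ : ∃ i, t i < s ∧ s ≤ t (i + 1) := by
      have hex : ∃ k, s ≤ t k := (htt.eventually (eventually_ge_atTop s)).exists
      classical
      have hk := Nat.find_spec hex
      obtain ⟨m, hm⟩ : ∃ m, Nat.find hex = m + 1 := by
        refine Nat.exists_eq_succ_of_ne_zero fun h0 => ?_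
        rw [h0, ht0] at hk
        linarith
      exact ⟨m, not_le.1 (Nat.find_min hex (by omega)), hm ▸ hk⟩
    obtain ⟨a, b, hab⟩ := hlin i
    have h1 : DifferentiableWithinAt ℝ (fun s => a * s + b) (Iic s) s := by fun_prop
    refine h1.congr_of_eventuallyEq ?_ (hab s ⟨hi1.le, hi2⟩)
    filter_upwards [Ioc_mem_nhdsLE hi1] with x hx
    exact hab x ⟨hx.1.le, hx.2.trans hi2⟩

theorem derivA_eq_slope {A : ℝ → ℝ} {u v a b s : ℝ} (hab : ∀ s ∈ Icc u v, A s = a * s + b)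
    (hu1 : 1 ≤ u) (hu : u < s) (hv : s ≤ v) : derivA A s = a := by
  rw [derivA, if_neg (by linarith)]
  have h1 : HasDerivWithinAt (fun s => a * s + b) a (Iic s) s := by
    simpa using ((hasDerivAt_id s).const_mul a).add_const b |>.hasDerivWithinAt (s := Iic s)
  refine HasDerivWithinAt.derivWithin (h1.congr_of_eventuallyEq ?_ (hab s ⟨hu.le, hv⟩))
    (uniqueDiffOn_Iic s s self_mem_Iic)
  filter_upwards [Ioc_mem_nhdsLE hu] with x hx
  exact hab x ⟨hx.1.le, hx.2.trans hv⟩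

/-- Makes the supremum in `gammaA` a genuine one, since `sSup` of an unbounded set of reals is 0. -/
theorem exists_abs_derivA_le {A : ℝ → ℝ} (hA : ContDiffOn ℝ 1 A (Ici 1) ∨ IsPiecewiseLinear A)
    (x : ℝ) : ∃ C, ∀ s ∈ Icc 1 x, |derivA A s| ≤ C := by
  rcases hA with hA | ⟨t, ht0, htm, htt, hlin⟩
  · have hc : ContinuousOn (derivWithin A (Ici 1)) (Icc 1 x) :=
      (hA.continuousOn_derivWithin (uniqueDiffOn_Ici 1) le_rfl).mono Icc_subset_Ici_self
    obtain ⟨C, hC⟩ := isCompact_Icc.exists_bound_of_continuousOn hc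
    refine ⟨C, fun s hs => ?_⟩
    rw [derivA_eq_of_contDiffOn hA hs.1]
    exact hC s hs
  · choose a b hab using hlin
    obtain ⟨N, hN⟩ := (htt.eventually (eventually_ge_atTop x)).exists
    refine ⟨|derivA A 1| + ∑ i ∈ Finset.range N, |a i|, fun s hs => ?_⟩
    rcases hs.1.eq_or_lt with h1 | h1
    · rw [← h1]
      exact le_add_of_nonneg_right (Finset.sum_nonneg fun _ _ => abs_nonneg _)
    · have hex : ∃ k, s ≤ t k := ⟨N, hs.2.trans hN⟩
      classical
      have hk := Nat.find_spec hex
      obtain ⟨m, hm⟩ : ∃ m, Nat.find hex = m + 1 := by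
        refine Nat.exists_eq_succ_of_ne_zero fun h0 => ?_
        rw [h0, ht0] at hk
        linarith
      have hmN : m < N := by
        have := Nat.find_min' hex (hs.2.trans hN)
        omega
      rw [derivA_eq_slope (hab m) (ht0 ▸ htm.monotone (Nat.zero_le m))
        (not_le.1 (Nat.find_min hex (by omega))) (hm ▸ hk)]
      exact (Finset.single_le_sum (f := fun i => |a i|) (fun _ _ => abs_nonneg _)
        (Finset.mem_range.2 hmN)).trans (le_add_of_nonneg_left (abs_nonneg _))

theorem mul_derivA_div_le_gammaA {A : ℝ → ℝ} (hpos : ∀ s ∈ Ici (1 : ℝ), 0 < A s)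
    (hmono : MonotoneOn A (Ici 1)) (hA : ContDiffOn ℝ 1 A (Ici 1) ∨ IsPiecewiseLinear A)
    {x s : ℝ} (hs : s ∈ Icc 1 x) : s * derivA A s / A s ≤ gammaA A x := by
  refine le_csSup ?_ (mem_image_of_mem _ hs)
  obtain ⟨C, hC⟩ := exists_abs_derivA_le hA x
  refine ⟨x * C / A 1, ?_⟩
  rintro _ ⟨s, hs, rfl⟩
  have h1 := hpos 1 self_mem_Ici
  have hC0 : 0 ≤ C := (abs_nonneg _).trans (hC s hs)
  have hle : A 1 ≤ A s := hmono self_mem_Ici hs.1 hs.1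
  have hs0 : 0 ≤ s := zero_le_one.trans hs.1
  have hx0 : 0 ≤ x := hs0.trans hs.2
  calc s * derivA A s / A s ≤ x * C / A s := by
        have := hpos s hs.1
        have h2 : s * derivA A s ≤ x * C :=
          (mul_le_mul_of_nonneg_left ((le_abs_self _).trans (hC s hs)) hs0).trans
            (mul_le_mul_of_nonneg_right hs.2 hC0)
        gcongr
    _ ≤ _ := by gcongr

theorem continuousOn_of_reg {A : ℝ → ℝ}
    (hA : ContDiffOn ℝ 1 A (Ici 1) ∨ IsPiecewiseLinear A) : ContinuousOn A (Ici 1) := by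
  rcases hA with hA | ⟨t, ht0, htm, htt, hlin⟩
  · exact hA.continuousOn
  · have key : ∀ N, ContinuousOn A (Icc 1 (t N)) := by
      intro N
      induction N with
      | zero =>
        rw [ht0, Icc_self]
        exact continuousOn_singleton _ _
      | succ N ih =>
        obtain ⟨a, b, hab⟩ := hlin N
        rw [← Icc_union_Icc_eq_Icc (b := t N) (ht0 ▸ htm.monotone (Nat.zero_le N))
          (htm.monotone (Nat.le_succ N))]
        refine ih.union_of_isClosed ?_ isClosed_Icc isClosed_Icc
        exact (by fun_prop : ContinuousOn (fun s => a * s + b) _).congr hab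
    intro s hs
    obtain ⟨N, hN⟩ := (htt.eventually (eventually_gt_atTop s)).exists
    refine (key N s ⟨hs, hN.le⟩).mono_of_mem_nhdsWithin ?_
    exact mem_nhdsWithin.2 ⟨Iio (t N), isOpen_Iio, hN, fun y hy => ⟨hy.2, hy.1.le⟩⟩

/-- `γ log s - log A(s)` has nonnegative left derivative, so it is nondecreasing. The reflection `σ
= -s` turns left derivatives into the right ones required by the comparison principle. -/
theorem le_mul_rpow_gammaA {A : ℝ → ℝ} (hpos : ∀ s ∈ Ici (1 : ℝ), 0 < A s)
    (hmono : MonotoneOn A (Ici 1)) (hA : ContDiffOn ℝ 1 A (Ici 1) ∨ IsPiecewiseLinear A)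
    {x s t : ℝ} (hs : 1 ≤ s) (hst : s ≤ t) (htx : t ≤ x) :
    A t ≤ A s * (t / s) ^ gammaA A x := by
  set γ := gammaA A x with hγ
  have hs0 : 0 < s := by linarith
  have ht0 : 0 < t := by linarith
  have hAs := hpos s hs
  have hAt := hpos t (hs.trans hst)
  have key := image_le_of_deriv_right_le_deriv_boundary (a := -t) (b := -s)
    (f := fun σ => γ * Real.log (-σ) - Real.log (A (-σ)))
    (f' := fun σ => γ / σ + derivA A (-σ) / A (-σ))
    (B := fun _ => γ * Real.log t - Real.log (A t)) (B' := fun _ => 0)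
    (by
      have hneg : MapsTo (fun σ : ℝ => -σ) (Icc (-t) (-s)) (Ici 1) := fun σ hσ => by
        show 1 ≤ -σ
        linarith [hσ.2]
      have h1 : ContinuousOn (fun σ : ℝ => A (-σ)) (Icc (-t) (-s)) :=
        (continuousOn_of_reg hA).comp continuous_neg.continuousOn hneg
      have h2 : ContinuousOn (fun σ : ℝ => Real.log (A (-σ))) (Icc (-t) (-s)) :=
        h1.log fun σ hσ => (hpos _ (hneg hσ)).ne'
      have h3 : ContinuousOn (fun σ : ℝ => Real.log (-σ)) (Icc (-t) (-s)) :=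
        continuous_neg.continuousOn.log fun σ hσ => by
          have := hneg hσ
          rw [mem_Ici] at this
          linarith
      exact (continuousOn_const.mul h3).sub h2)
    (fun σ hσ => by
      have hσ1 : 1 < -σ := by linarith [hσ.2]
      have h1 : HasDerivWithinAt (fun σ : ℝ => A (-σ)) (derivA A (-σ) * (-1)) (Ici σ) σ :=
        HasDerivWithinAt.comp σ (hasDerivWithinAt_derivA hA hσ1)
          (hasDerivAt_neg σ).hasDerivWithinAt (fun y hy => mem_Iic.2 (neg_le_neg (mem_Ici.1 hy)))
      have h2 := h1.log (hpos _ hσ1.le).ne'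
      have h3 : HasDerivWithinAt (fun σ : ℝ => Real.log (-σ)) (-1 / -σ) (Ici σ) σ :=
        (hasDerivAt_neg σ).hasDerivWithinAt.log (by linarith)
      refine ((h3.const_mul γ).sub h2).congr_deriv ?_
      have : -1 / -σ = 1 / σ := by rw [neg_div_neg_eq]
      rw [this]
      ring)
    (by
      simp only [neg_neg]
      exact le_rfl)
    continuousOn_const (fun σ _ => hasDerivWithinAt_const _ _ _)
    (fun σ hσ => by
      have hσ1 : 1 < -σ := by linarith [hσ.2]
      have h1 := mul_derivA_div_le_gammaA hpos hmono hA (x := x) (s := -σ)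
        ⟨hσ1.le, by linarith [hσ.1]⟩
      have h2 : derivA A (-σ) / A (-σ) ≤ γ / -σ := by
        rw [le_div_iff₀ (by linarith)]
        calc _ = -σ * derivA A (-σ) / A (-σ) := by ring
          _ ≤ _ := h1
      have h3 : γ / -σ = -(γ / σ) := by rw [div_neg]
      linarith)
    (right_mem_Icc.2 (neg_le_neg hst))
  simp only [neg_neg] at key
  rw [← Real.log_le_log_iff hAt (by positivity), Real.log_mul hAs.ne' (by positivity),
    Real.log_rpow (by positivity), Real.log_div ht0.ne' hs0.ne']
  linarith

/-- A negative exponent in the growth bound would force `A x < A 1`. -/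
theorem gammaA_nonneg {A : ℝ → ℝ} (hpos : ∀ s ∈ Ici (1 : ℝ), 0 < A s)
    (hmono : MonotoneOn A (Ici 1)) (hA : ContDiffOn ℝ 1 A (Ici 1) ∨ IsPiecewiseLinear A)
    {x : ℝ} (hx : 1 < x) : 0 ≤ gammaA A x := by
  by_contra! hneg
  have h1 := le_mul_rpow_gammaA hpos hmono hA le_rfl hx.le le_rfl
  have h2 : (x / 1) ^ gammaA A x < 1 := Real.rpow_lt_one_of_one_lt_of_neg (by simpa using hx) hneg
  have h3 : A 1 ≤ A x := hmono self_mem_Ici hx.le hx.le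
  have h4 := hpos 1 self_mem_Ici
  nlinarith

/-! ### The Carleman class and the Bang degree -/

theorem hasDerivWithinAt_iteratedDerivWithin_Icc {f : ℝ → ℝ} (hf : ContDiffOn ℝ ∞ f (Icc 0 1))
    (j : ℕ) : ∀ x ∈ Icc (0 : ℝ) 1, HasDerivWithinAt (iteratedDerivWithin j f (Icc 0 1))
      (iteratedDerivWithin (j + 1) f (Icc 0 1) x) (Icc 0 1) x := by
  intro x hx
  rw [iteratedDerivWithin_succ]
  exact ((hf.differentiableOn_iteratedDerivWithin (by exact_mod_cast ENat.natCast_lt_top j)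
    (uniqueDiffOn_Icc zero_lt_one)) x hx).hasDerivWithinAt

theorem M_zero (A : ℝ → ℝ) : M A 0 = 1 := by simp [M]

theorem M_succ (A : ℝ → ℝ) (j : ℕ) : M A (j + 1) = M A j * A ((j + 1 : ℕ) : ℝ) := by
  rw [M, Finset.prod_range_succ, M]

theorem natCast_mem_Ici_one {l : ℕ} (hl : 1 ≤ l) : (l : ℝ) ∈ Ici (1 : ℝ) := by
  rw [mem_Ici]
  exact_mod_cast hl

theorem M_pos {A : ℝ → ℝ} (hpos : ∀ s ∈ Ici (1 : ℝ), 0 < A s) (j : ℕ) : 0 < M A j :=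
  Finset.prod_pos fun i _ => hpos _ (natCast_mem_Ici_one (Nat.le_add_left 1 i))

theorem supNorm_nonneg (f : ℝ → ℝ) (K : Set ℝ) : 0 ≤ supNorm f K :=
  Real.sSup_nonneg (by rintro _ ⟨x, _, rfl⟩; exact abs_nonneg _)

theorem supNorm_le {f : ℝ → ℝ} {K : Set ℝ} {C : ℝ} (hC : 0 ≤ C) (h : ∀ x ∈ K, |f x| ≤ C) :
    supNorm f K ≤ C :=
  Real.sSup_le (by rintro _ ⟨x, hx, rfl⟩; exact h x hx) hC

theorem abs_le_supNorm {f : ℝ → ℝ} {K : Set ℝ} {C : ℝ} (h : ∀ x ∈ K, |f x| ≤ C) {x : ℝ}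
    (hx : x ∈ K) : |f x| ≤ supNorm f K :=
  le_csSup ⟨C, by rintro _ ⟨x, hx, rfl⟩; exact h x hx⟩ (mem_image_of_mem _ hx)

/-- By maximality of `n` the Bang sum up to `n + 1` is at least `e`. Its terms are `1 / A j`,
starting at the least admissible index `k`, so the sum is at most `e` times the level point of `k`.
-/
theorem exists_level_of_bangDegree {A : ℝ → ℝ} (hpos : ∀ s ∈ Ici (1 : ℝ), 0 < A s)
    {f : ℝ → ℝ} {n : ℕ} (hdeg : bangDegree A f = (n : ℕ∞)) :
    ∃ k, 1 ≤ k ∧ k ≤ n + 1 ∧ Real.exp (-k) < supNorm f (Icc 0 1) ∧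
      1 ≤ levelPoint (fun l : ℕ => (A l)⁻¹) (n + 1) k := by
  have hsum : Real.exp 1 ≤ bangSum A f (n + 1) := by
    by_contra! hlt
    have h1 : ((n + 1 : ℕ) : ℕ∞) ≤ bangDegree A f :=
      le_iSup₂ (f := fun (N : ℕ) (_ : N ∈ {N : ℕ | bangSum A f N < Real.exp 1}) => (N : ℕ∞))
        (n + 1) hlt
    rw [hdeg] at h1
    have : n + 1 ≤ n := by exact_mod_cast h1
    omega
  classical
  -- An index occurs in the sum, since an empty sum would be 0. This also yields `0 < supNorm f (Icc
  -- 0 1)`.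
  have hex : ∃ j : ℕ, (1 ≤ j ∧ j ≤ n + 1) ∧ 0 < supNorm f (Icc 0 1) ∧
      Real.log (supNorm f (Icc 0 1))⁻¹ < j := by
    by_contra! hcon
    have : bangSum A f (n + 1) = 0 := by
      rw [bangSum, Finset.sum_eq_zero]
      intro j hj
      rw [Finset.mem_filter, Finset.mem_Icc] at hj
      exact absurd hj.2.2 (not_lt.2 (hcon j hj.1 hj.2.1))
    rw [this] at hsum
    exact absurd (Real.exp_pos 1) (not_lt.2 hsum)
  obtain ⟨⟨hk1, hkn⟩, hs0, hks⟩ := Nat.find_spec hex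
  set k := Nat.find hex
  refine ⟨k, hk1, hkn, ?_, ?_⟩
  · rw [Real.log_inv] at hks
    rw [← Real.lt_log_iff_exp_lt hs0]
    linarith
  · rw [levelPoint, le_div_iff₀ (Real.exp_pos 1), one_mul]
    refine hsum.trans ?_
    rw [bangSum]
    have hterm : ∀ j : ℕ, 1 ≤ j → M A (j - 1) / M A j = (A j)⁻¹ := by
      intro j hj
      obtain ⟨i, rfl⟩ : ∃ i, j = i + 1 := ⟨j - 1, by omega⟩
      rw [M_succ, Nat.add_sub_cancel]
      have h1 := (M_pos hpos i).ne'
      have h2 := (hpos _ (natCast_mem_Ici_one (Nat.le_add_left 1 i))).ne'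
      field_simp
    refine (Finset.sum_congr rfl fun j hj => hterm j ?_).trans_le
      (Finset.sum_le_sum_of_subset_of_nonneg ?_ fun j hj _ => ?_)
    · rw [Finset.mem_filter, Finset.mem_Icc] at hj
      exact hj.1.1
    · intro j hj
      rw [Finset.mem_filter, Finset.mem_Icc] at hj
      rw [Finset.mem_Ico]
      exact ⟨Nat.find_min' hex hj, by omega⟩
    · rw [Finset.mem_Ico] at hj
      exact (inv_pos.2 (hpos _ (natCast_mem_Ici_one (by omega)))).le

theorem abs_sub_le_volume_real {I : Set ℝ} (hI : I.OrdConnected) (hI01 : I ⊆ Icc 0 1) {x y : ℝ}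
    (hx : x ∈ I) (hy : y ∈ I) : |x - y| ≤ volume.real I := by
  have h1 : uIcc y x ⊆ I := hI.uIcc_subset hy hx
  have h2 : volume I ≠ ⊤ := ((measure_mono hI01).trans_lt (by simp)).ne
  have h3 := measureReal_mono h1 h2
  rwa [Real.volume_real_interval] at h3

/-! ### Interpolation of `f` and the lower bound from the Bang degree -/

section Interpolation

variable {A f : ℝ → ℝ} {n : ℕ} {d δ X : ℝ} {z : ℕ → ℝ}

/-- The derivatives of the difference of `f` and its interpolation polynomial. -/
noncomputable def interpolationError (f : ℝ → ℝ) (n : ℕ) (z : ℕ → ℝ) (j : ℕ) (x : ℝ) : ℝ :=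
  iteratedDerivWithin j f (Icc 0 1) x -
    (Polynomial.derivative^[j] (Lagrange.interpolate (Finset.range (n + 1)) z
      fun i => f (z i))).eval x

theorem hasDerivWithinAt_interpolationError (hf : ContDiffOn ℝ ∞ f (Icc 0 1)) (n : ℕ) (z : ℕ → ℝ)
    (j : ℕ) : ∀ x ∈ Icc (0 : ℝ) 1, HasDerivWithinAt (interpolationError f n z j)
      (interpolationError f n z (j + 1) x) (Icc 0 1) x := by
  intro x hx
  unfold interpolationError
  rw [Function.iterate_succ_apply']
  exact (hasDerivWithinAt_iteratedDerivWithin_Icc hf j x hx).sub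
    (Polynomial.hasDerivAt _ x).hasDerivWithinAt

theorem lt_of_separated (hd : 0 < d) (hz : ∀ i < n, z i + d ≤ z (i + 1)) :
    ∀ i < n, z i < z (i + 1) := fun i hi => by linarith [hz i hi]

theorem interpolationError_node (hd : 0 < d) (hz : ∀ i < n, z i + d ≤ z (i + 1)) :
    ∀ i ≤ n, interpolationError f n z 0 (z i) = 0 := by
  intro i hi
  rw [interpolationError, iteratedDerivWithin_zero, Function.iterate_zero, id,
    Lagrange.eval_interpolate_at_node _ (injOn_of_separated hd hz)
      (Finset.mem_range.2 (by omega)), sub_self]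

theorem interpolationError_top (hd : 0 < d) (hz : ∀ i < n, z i + d ≤ z (i + 1)) (x : ℝ) :
    interpolationError f n z (n + 1) x = iteratedDerivWithin (n + 1) f (Icc 0 1) x := by
  have h := Lagrange.degree_interpolate_lt (fun i => f (z i)) (injOn_of_separated hd hz)
  rw [Finset.card_range] at h
  rw [interpolationError, Polynomial.iterate_derivative_eq_zero_of_degree_lt h]
  simp

/-- The polynomial part is bounded through its nodal values. The error has a short chain of zeros,
and its derivative of order `n + 1` is that of `f`. -/
theorem abs_le_of_interpolation (hpos : ∀ s ∈ Ici (1 : ℝ), 0 < A s) (hf : f ∈ carlemanClass A)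
    (hd : 0 < d) (hz : ∀ i < n, z i + d ≤ z (i + 1)) (hz01 : ∀ i ≤ n, z i ∈ Icc (0 : ℝ) 1)
    (hδ : ∀ i ≤ n, |f (z i)| ≤ δ) {x : ℝ} (hx : x ∈ Icc (0 : ℝ) 1) (hX : ∀ i ≤ n, |x - z i| ≤ X)
    (hzX : z n - z 0 ≤ X) :
    |f x| ≤ δ * (2 / d) ^ n * X ^ n / n.factorial +
      M A (n + 1) * X ^ (n + 1) / (n + 1).factorial := by
  obtain ⟨ξ, hξ, hlen⟩ := exists_short_zero_chain
    (hasDerivWithinAt_interpolationError hf.1 n z) (lt_of_separated hd hz) hz01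
    (interpolationError_node hd hz) x
  have h1 := abs_le_pow_div_factorial_of_zero_chain
    (hasDerivWithinAt_interpolationError hf.1 n z) (ξ := ξ)
    (fun j hj => ⟨(hξ j hj).1, Icc_subset_Icc (hz01 0 (Nat.zero_le n)).1 (hz01 n le_rfl).2
      (hξ j hj).2⟩) (M_pos hpos (n + 1)).le
    (fun y hy => by rw [interpolationError_top hd hz]; exact hf.2 (n + 1) y hy)
    (Nat.zero_le n) x hx
  have hmax : max x (z n) - min x (z 0) ≤ X := by
    have h0 := abs_le.1 (hX 0 (Nat.zero_le n))
    have hn := abs_le.1 (hX n le_rfl)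
    have hX0 : 0 ≤ X := (abs_nonneg _).trans (hX n le_rfl)
    rcases max_choice x (z n) with h | h <;> rcases min_choice x (z 0) with h' | h' <;>
      rw [h, h'] <;> linarith
  rw [chainLength_zero] at h1
  have h2 : |interpolationError f n z 0 x| ≤ M A (n + 1) * X ^ (n + 1) / (n + 1).factorial := by
    refine h1.trans ?_
    rw [Nat.sub_zero]
    have := (M_pos hpos (n + 1)).le
    have hs : 0 ≤ ∑ i ∈ Finset.range n, |ξ i - ξ (i + 1)| :=
      Finset.sum_nonneg fun _ _ => abs_nonneg _
    gcongr
    exact hlen.trans hmax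
  have h3 := abs_eval_iterate_derivative_interpolate_le hd hz hδ hX (Nat.zero_le n)
  have h4 : f x = (Polynomial.derivative^[0] (Lagrange.interpolate (Finset.range (n + 1)) z
      fun i => f (z i))).eval x + interpolationError f n z 0 x := by
    rw [interpolationError, iteratedDerivWithin_zero]
    ring
  rw [h4]
  rw [Nat.sub_zero] at h3
  exact (abs_add_le _ _).trans (add_le_add h3 h2)

/-- The quotient `A(j+1) / A(j+2)`, with `A(j+2)` replaced by `A(n+1)` for `j = n`. -/
noncomputable def stepRatio (A : ℝ → ℝ) (n j : ℕ) : ℝ :=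
  A ((j + 1 : ℕ) : ℝ) / A ((min (j + 2) (n + 1) : ℕ) : ℝ)

theorem stepRatio_pos (hpos : ∀ s ∈ Ici (1 : ℝ), 0 < A s) (n j : ℕ) : 0 < stepRatio A n j :=
  div_pos (hpos _ (natCast_mem_Ici_one (by omega))) (hpos _ (natCast_mem_Ici_one (by omega)))

/-- Otherwise the interpolation polynomial, and with it `f`, has small derivatives along a chain of
zeros of the error starting near any prescribed `x` in the sense of total length at most 1; then `|f
x| ≤ e^(-k)` for all `x`, against the choice of `k`. -/
theorem exists_lt_of_bangDegree (hpos : ∀ s ∈ Ici (1 : ℝ), 0 < A s)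
    (hmono : MonotoneOn A (Ici 1)) (hf : f ∈ carlemanClass A) (hn : 1 ≤ n)
    (hdeg : bangDegree A f = (n : ℕ∞))
    (hd : 0 < d) (hz : ∀ i < n, z i + d ≤ z (i + 1)) (hz01 : ∀ i ≤ n, z i ∈ Icc (0 : ℝ) 1)
    (hδ : ∀ i ≤ n, |f (z i)| ≤ δ) (hzX : z n - z 0 ≤ X) :
    ∃ j ≤ n, stepRatio A n j * Real.exp ((j : ℝ) - n - 4) * M A j <
      δ * (2 / d) ^ n * X ^ (n - j) / (n - j).factorial := by
  obtain ⟨k, hk1, hkn, hks, hlev⟩ := exists_level_of_bangDegree hpos hdeg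
  by_contra! hcon
  refine absurd (supNorm_le (Real.exp_pos (-(k : ℝ))).le fun x hx => ?_) (not_le.2 hks)
  obtain ⟨ξ, hξ, hlen⟩ := exists_short_zero_chain
    (hasDerivWithinAt_interpolationError hf.1 n z) (lt_of_separated hd hz) hz01
    (interpolationError_node hd hz) x
  have hz0 := hz01 0 (Nat.zero_le n)
  have hzn := hz01 n le_rfl
  have hmax : max x (z n) - min x (z 0) ≤ 1 := by
    have h1 : max x (z n) ≤ 1 := max_le hx.2 hzn.2
    have h2 : 0 ≤ min x (z 0) := le_min hx.1 hz0.1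
    linarith
  have hApos : ∀ l : ℕ, 1 ≤ l → 0 < A l := fun l hl => hpos _ (natCast_mem_Ici_one hl)
  have key := abs_le_exp_neg_of_small_chain hn
    (hasDerivWithinAt_iteratedDerivWithin_Icc hf.1) (m := M A) (a := fun l : ℕ => (A l)⁻¹)
    (η := fun j => stepRatio A n j * Real.exp ((j : ℝ) - n - 4)) (ξ := ξ)
    (fun l hl _ => inv_pos.2 (hApos l hl))
    (fun l hl _ => inv_anti₀ (hApos l hl) (hmono (natCast_mem_Ici_one hl)
      (natCast_mem_Ici_one (by omega)) (by push_cast; linarith)))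
    (fun j _ => (M_pos hpos j).le)
    (fun j _ => by
      rw [M_succ]
      have := (hApos (j + 1) (by omega)).ne'
      field_simp)
    (fun j _ => hf.2 j)
    (fun j hj => Icc_subset_Icc hz0.1 hzn.2 (hξ j hj).2)
    (fun j hj => by
      have h1 : iteratedDerivWithin j f (Icc 0 1) (ξ j) =
          (Polynomial.derivative^[j] (Lagrange.interpolate (Finset.range (n + 1)) z
            fun i => f (z i))).eval (ξ j) := sub_eq_zero.1 (hξ j hj).1
      rw [h1]
      refine (abs_eval_iterate_derivative_interpolate_le hd hz hδ (fun i hi => ?_) hj).trans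
        (hcon j hj)
      have hm := fun j hj => (lt_of_separated hd hz j hj).le
      have h2 := monotone_chain_le hm (Nat.zero_le i) hi
      have h3 := monotone_chain_le hm hi le_rfl
      have h4 := (hξ j hj).2
      rw [abs_le]
      constructor <;> linarith [h4.1, h4.2])
    (fun j _ => (mul_pos (stepRatio_pos hpos n j) (Real.exp_pos _)).le)
    (by
      -- For `j = n` the minimum in `stepRatio` makes the ratio 1, so the smallness demanded is
      -- `e^(-4) ≤ 1/50`.
      have h1 : stepRatio A n n = 1 := by
        rw [stepRatio, min_eq_right (by omega)]
        exact div_self (hApos (n + 1) (by omega)).ne'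
      simp only [h1, one_mul, sub_self, zero_sub]
      rw [Real.exp_neg, ← one_div]
      apply one_div_le_one_div_of_le (by norm_num)
      have h4 : Real.exp 4 = Real.exp 1 ^ 4 := by rw [← Real.exp_nat_mul]; norm_num
      rw [h4]
      calc (50 : ℝ) ≤ 2.7 ^ 4 := by norm_num
        _ ≤ _ := by gcongr; linarith [Real.exp_one_gt_d9])
    (fun j hj => by
      simp only [stepRatio]
      rw [min_eq_left (by omega), inv_div_inv])
    hk1 hkn hx (by
      rw [chainLength_zero]
      exact (hlen.trans hmax).trans hlev)
  rwa [iteratedDerivWithin_zero, M_zero, one_mul] at key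

end Interpolation

/-! ### Numerical consequences of the growth of `A` -/

section Numerics

variable {A : ℝ → ℝ} {n : ℕ} {γ : ℝ}

theorem le_stepRatio_mul_rpow (hpos : ∀ s ∈ Ici (1 : ℝ), 0 < A s) (hγ : 0 ≤ γ)
    (hA : ∀ i k : ℕ, 1 ≤ i → i ≤ k → k ≤ n + 1 → A k ≤ A i * ((k : ℝ) / i) ^ γ)
    {j : ℕ} (hj : j ≤ n) : 1 ≤ stepRatio A n j * (((n + 1 : ℕ) : ℝ) / (j + 1 : ℕ)) ^ γ := by
  have h1 := hA (j + 1) (min (j + 2) (n + 1)) (by omega) (by omega) (by omega)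
  have h2 : 0 < A ((min (j + 2) (n + 1) : ℕ) : ℝ) := hpos _ (natCast_mem_Ici_one (by omega))
  have h3 : 0 < A ((j + 1 : ℕ) : ℝ) := hpos _ (natCast_mem_Ici_one (by omega))
  rw [stepRatio, div_mul_eq_mul_div, le_div_iff₀ h2, one_mul]
  refine h1.trans (mul_le_mul_of_nonneg_left ?_ h3.le)
  have h4 : ((min (j + 2) (n + 1) : ℕ) : ℝ) ≤ ((n + 1 : ℕ) : ℝ) := by
    exact_mod_cast min_le_right _ _
  gcongr

theorem le_stepRatio_mul_exp (hpos : ∀ s ∈ Ici (1 : ℝ), 0 < A s) (hγ : 0 ≤ γ)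
    (hA : ∀ i k : ℕ, 1 ≤ i → i ≤ k → k ≤ n + 1 → A k ≤ A i * ((k : ℝ) / i) ^ γ)
    {j : ℕ} (hj : j ≤ n) : 1 ≤ stepRatio A n j * Real.exp γ := by
  have h1 := hA (j + 1) (min (j + 2) (n + 1)) (by omega) (by omega) (by omega)
  have h2 : 0 < A ((min (j + 2) (n + 1) : ℕ) : ℝ) := hpos _ (natCast_mem_Ici_one (by omega))
  have h3 : 0 < A ((j + 1 : ℕ) : ℝ) := hpos _ (natCast_mem_Ici_one (by omega))
  rw [stepRatio, div_mul_eq_mul_div, le_div_iff₀ h2, one_mul]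
  refine h1.trans (mul_le_mul_of_nonneg_left ?_ h3.le)
  rw [← Real.exp_one_rpow]
  refine Real.rpow_le_rpow (by positivity) ?_ hγ
  rw [div_le_iff₀ (by positivity)]
  have h4 : ((min (j + 2) (n + 1) : ℕ) : ℝ) ≤ ((j + 2 : ℕ) : ℝ) := by
    exact_mod_cast min_le_left _ _
  have h5 := Real.exp_one_gt_d9
  push_cast at h4 ⊢
  nlinarith [(Nat.cast_nonneg j : (0 : ℝ) ≤ j)]

/-- Product of the inequalities `A(n+1) ≤ A(i) ((n+1)/i)^γ` over `1 ≤ i ≤ j`. -/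
theorem pow_le_M_mul_rpow (hpos : ∀ s ∈ Ici (1 : ℝ), 0 < A s)
    (hA : ∀ i k : ℕ, 1 ≤ i → i ≤ k → k ≤ n + 1 → A k ≤ A i * ((k : ℝ) / i) ^ γ)
    {j : ℕ} (hj : j ≤ n + 1) :
    A ((n + 1 : ℕ) : ℝ) ^ j ≤ M A j * (((n + 1 : ℕ) : ℝ) ^ j / j.factorial) ^ γ := by
  have hL := hpos _ (natCast_mem_Ici_one (Nat.le_add_left 1 n))
  induction j with
  | zero => simp [M_zero]
  | succ j ih =>
    have h1 := ih (by omega)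
    have h2 := hA (j + 1) (n + 1) (by omega) hj le_rfl
    have hM := M_pos hpos j
    calc _ = A ((n + 1 : ℕ) : ℝ) ^ j * A ((n + 1 : ℕ) : ℝ) := pow_succ _ _
      _ ≤ (M A j * (((n + 1 : ℕ) : ℝ) ^ j / j.factorial) ^ γ) *
          (A ((j + 1 : ℕ) : ℝ) * (((n + 1 : ℕ) : ℝ) / (j + 1 : ℕ)) ^ γ) := by gcongr
      _ = M A (j + 1) * ((((n + 1 : ℕ) : ℝ) ^ j / j.factorial) ^ γ *
          (((n + 1 : ℕ) : ℝ) / (j + 1 : ℕ)) ^ γ) := by rw [M_succ]; ring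
      _ = _ := by
        rw [← Real.mul_rpow (by positivity) (by positivity)]
        congr 2
        rw [Nat.factorial_succ]
        push_cast
        field_simp
        ring

/-- The step ratio costs one more factor `((n+1)/(j+1))^γ`, which completes the base of the power to
`(n+1)^(j+1)/(j+1)! ≤ e^(n+1)`. -/
theorem pow_le_stepRatio_mul_M_mul_exp (hpos : ∀ s ∈ Ici (1 : ℝ), 0 < A s) (hγ : 0 ≤ γ)
    (hA : ∀ i k : ℕ, 1 ≤ i → i ≤ k → k ≤ n + 1 → A k ≤ A i * ((k : ℝ) / i) ^ γ)
    {j : ℕ} (hj : j ≤ n) :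
    A ((n + 1 : ℕ) : ℝ) ^ j ≤ stepRatio A n j * M A j * Real.exp (γ * (n + 1)) := by
  have h1 := pow_le_M_mul_rpow hpos hA (show j ≤ n + 1 by omega)
  have h2 := le_stepRatio_mul_rpow hpos hγ hA hj
  have hM := M_pos hpos j
  have hr := stepRatio_pos hpos n j
  have h3 : (((n + 1 : ℕ) : ℝ) ^ j / j.factorial) * (((n + 1 : ℕ) : ℝ) / (j + 1 : ℕ)) ≤
      Real.exp ((n + 1 : ℕ) : ℝ) := by
    have := Real.pow_div_factorial_le_exp (x := ((n + 1 : ℕ) : ℝ)) (by positivity) (j + 1)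
    refine le_trans (le_of_eq ?_) this
    rw [Nat.factorial_succ]
    push_cast
    field_simp
    ring
  calc _ ≤ M A j * (((n + 1 : ℕ) : ℝ) ^ j / j.factorial) ^ γ * 1 := by rwa [mul_one]
    _ ≤ M A j * (((n + 1 : ℕ) : ℝ) ^ j / j.factorial) ^ γ *
        (stepRatio A n j * (((n + 1 : ℕ) : ℝ) / (j + 1 : ℕ)) ^ γ) := by gcongr
    _ = stepRatio A n j * M A j * ((((n + 1 : ℕ) : ℝ) ^ j / j.factorial) *
        (((n + 1 : ℕ) : ℝ) / (j + 1 : ℕ))) ^ γ := by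
      rw [Real.mul_rpow (by positivity) (by positivity)]
      ring
    _ ≤ stepRatio A n j * M A j * (Real.exp ((n + 1 : ℕ) : ℝ)) ^ γ := by gcongr
    _ = _ := by
      rw [← Real.exp_mul]
      congr 2
      push_cast
      ring

theorem M_le_mul_pow (hpos : ∀ s ∈ Ici (1 : ℝ), 0 < A s) (hmono : MonotoneOn A (Ici 1))
    {j k : ℕ} (hjk : j ≤ k) : M A k ≤ M A j * A (k : ℝ) ^ (k - j) := by
  have key : ∀ m, j ≤ m → m ≤ k → M A m ≤ M A j * A (k : ℝ) ^ (m - j) := by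
    intro m hm
    induction m, hm using Nat.le_induction with
    | base => simp
    | succ m hm ih =>
      intro hmk
      have h1 := ih (by omega)
      have h2 : A ((m + 1 : ℕ) : ℝ) ≤ A (k : ℝ) := hmono (natCast_mem_Ici_one (by omega))
        (natCast_mem_Ici_one (by omega)) (by exact_mod_cast hmk)
      have h3 := hpos _ (natCast_mem_Ici_one (Nat.le_add_left 1 m))
      have h4 : 0 < A (k : ℝ) := h3.trans_le h2
      have h5 := M_pos hpos j
      rw [M_succ, show m + 1 - j = (m - j) + 1 by omega, pow_succ, ← mul_assoc]
      gcongr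
  exact key k hjk le_rfl

/-- The two lower bounds for `Q` combined, in the cases of long and of short intervals. -/
theorem le_mul_exp_of_bounds (hpos : ∀ s ∈ Ici (1 : ℝ), 0 < A s) (hmono : MonotoneOn A (Ici 1))
    (hγ : 0 ≤ γ) (hA : ∀ i k : ℕ, 1 ≤ i → i ≤ k → k ≤ n + 1 → A k ≤ A i * ((k : ℝ) / i) ^ γ)
    (hn : 1 ≤ n) {m Q X : ℝ} (hQ : 0 ≤ Q) (hX : 0 < X) (hm1 : m ≤ 1) {j : ℕ} (hj : j ≤ n)
    (h1 : stepRatio A n j * M A j * X ^ j ≤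
      Q * ((n + 1 : ℕ) : ℝ) ^ j * Real.exp (2 * n + 5))
    (h2 : m ≤ Q * Real.exp (n + 1) + M A (n + 1) * X ^ (n + 1) / (n + 1).factorial) :
    m ≤ Q * (8 ^ n * Real.exp (8 * n + 2 * n * γ)) := by
  have hn1 : (1 : ℝ) ≤ n := by exact_mod_cast hn
  have hγn : γ ≤ n * γ := le_mul_of_one_le_left hγ hn1
  have hL : (0 : ℝ) < ((n + 1 : ℕ) : ℝ) := by positivity
  have hAL := hpos _ (natCast_mem_Ici_one (Nat.le_add_left 1 n))
  have hM := M_pos hpos j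
  have hr := stepRatio_pos hpos n j
  have h8 : (8 : ℝ) ≤ 8 ^ n := le_self_pow₀ (by norm_num) (by omega)
  -- Long intervals: `(X A(n+1))^j ≥ (n+1)^j`, so the first bound alone gives `1 ≤ CQ`. Short
  -- intervals: `M_(n+1) X^(n+1) ≤ M_j X^j (n+1)^(n+1-j)`, and the first bound controls the
  -- remainder.
  rcases le_total ((n + 1 : ℕ) : ℝ) (X * A ((n + 1 : ℕ) : ℝ)) with hc | hc
  · have h3 := pow_le_stepRatio_mul_M_mul_exp hpos hγ hA hj
    have h4 : ((n + 1 : ℕ) : ℝ) ^ j * 1 ≤ ((n + 1 : ℕ) : ℝ) ^ j *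
        (Q * Real.exp (2 * n + 5) * Real.exp (γ * (n + 1))) :=
      calc _ = ((n + 1 : ℕ) : ℝ) ^ j := mul_one _
        _ ≤ (X * A ((n + 1 : ℕ) : ℝ)) ^ j := by gcongr
        _ = A ((n + 1 : ℕ) : ℝ) ^ j * X ^ j := by rw [mul_pow, mul_comm]
        _ ≤ stepRatio A n j * M A j * Real.exp (γ * (n + 1)) * X ^ j := by gcongr
        _ = stepRatio A n j * M A j * X ^ j * Real.exp (γ * (n + 1)) := by ring
        _ ≤ (Q * ((n + 1 : ℕ) : ℝ) ^ j * Real.exp (2 * n + 5)) * Real.exp (γ * (n + 1)) := by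
          gcongr
        _ = _ := by ring
    have h5 := le_of_mul_le_mul_left h4 (by positivity)
    rw [mul_assoc, ← Real.exp_add] at h5
    refine hm1.trans (h5.trans (mul_le_mul_of_nonneg_left ?_ hQ))
    calc _ ≤ 1 * Real.exp (8 * n + 2 * n * γ) := by
          rw [one_mul]
          apply Real.exp_le_exp.2
          linarith
      _ ≤ _ := by gcongr; linarith
  · have h3 := le_stepRatio_mul_exp hpos hγ hA hj
    have h4 := M_le_mul_pow hpos hmono (show j ≤ n + 1 by omega)
    have hXj : M A j * X ^ j ≤
        Q * ((n + 1 : ℕ) : ℝ) ^ j * Real.exp (2 * n + 5) * Real.exp γ :=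
      calc _ = M A j * X ^ j * 1 := (mul_one _).symm
        _ ≤ M A j * X ^ j * (stepRatio A n j * Real.exp γ) := by gcongr
        _ = stepRatio A n j * M A j * X ^ j * Real.exp γ := by ring
        _ ≤ _ := by gcongr
    have hpw : X ^ (n + 1) = X ^ j * X ^ (n + 1 - j) := by
      rw [← pow_add]; congr 1; omega
    have hpL : ((n + 1 : ℕ) : ℝ) ^ (n + 1) =
        ((n + 1 : ℕ) : ℝ) ^ j * ((n + 1 : ℕ) : ℝ) ^ (n + 1 - j) := by
      rw [← pow_add]; congr 1; omega
    have h5 : M A (n + 1) * X ^ (n + 1) ≤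
        Q * Real.exp (2 * n + 5) * Real.exp γ * ((n + 1 : ℕ) : ℝ) ^ (n + 1) :=
      calc _ ≤ (M A j * A ((n + 1 : ℕ) : ℝ) ^ (n + 1 - j)) * X ^ (n + 1) := by gcongr
        _ = (M A j * X ^ j) * (X * A ((n + 1 : ℕ) : ℝ)) ^ (n + 1 - j) := by
          rw [hpw, mul_pow]; ring
        _ ≤ (Q * ((n + 1 : ℕ) : ℝ) ^ j * Real.exp (2 * n + 5) * Real.exp γ) *
            ((n + 1 : ℕ) : ℝ) ^ (n + 1 - j) := by gcongr
        _ = _ := by rw [hpL]; ring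
    have h6 := Real.pow_div_factorial_le_exp (x := ((n + 1 : ℕ) : ℝ)) hL.le (n + 1)
    have h7 : M A (n + 1) * X ^ (n + 1) / (n + 1).factorial ≤
        Q * Real.exp (3 * n + 6 + γ) :=
      calc _ ≤ Q * Real.exp (2 * n + 5) * Real.exp γ * ((n + 1 : ℕ) : ℝ) ^ (n + 1) /
            (n + 1).factorial := by gcongr
        _ = Q * Real.exp (2 * n + 5) * Real.exp γ * (((n + 1 : ℕ) : ℝ) ^ (n + 1) /
            (n + 1).factorial) := by ring
        _ ≤ Q * Real.exp (2 * n + 5) * Real.exp γ * Real.exp ((n + 1 : ℕ) : ℝ) := by gcongr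
        _ = _ := by
          rw [mul_assoc, mul_assoc, ← Real.exp_add, ← Real.exp_add]
          congr 2
          push_cast
          ring
    have h8' : Real.exp ((n : ℝ) + 1) ≤ Real.exp (3 * n + 6 + γ) :=
      Real.exp_le_exp.2 (by linarith)
    have h9 : Real.exp (3 * n + 6 + γ) ≤ Real.exp 1 * Real.exp (8 * n + 2 * n * γ) := by
      rw [← Real.exp_add]
      exact Real.exp_le_exp.2 (by linarith)
    have h10 := Real.exp_one_lt_d9
    have h11 := Real.exp_pos (8 * n + 2 * n * γ)
    -- Here `3n + 6 ≤ 8n + 1` because `n ≥ 1`, and `2e < 8 ≤ 8^n` absorbs the rest.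
    calc m ≤ Q * Real.exp (3 * n + 6 + γ) + Q * Real.exp (3 * n + 6 + γ) :=
          h2.trans (add_le_add (mul_le_mul_of_nonneg_left h8' hQ) h7)
      _ = Q * (2 * Real.exp (3 * n + 6 + γ)) := by ring
      _ ≤ _ := mul_le_mul_of_nonneg_left (by nlinarith) hQ

end Numerics

end DenjoyCarleman

/-! ### The Remez-type inequality -/

theorem theoremB
    (A : ℝ → ℝ)
    (hA_pos : ∀ s ∈ Ici (1 : ℝ), 0 < A s)
    (hA_mono : MonotoneOn A (Ici 1))
    (hA_reg : ContDiffOn ℝ 1 A (Ici 1) ∨ DenjoyCarleman.IsPiecewiseLinear A)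
    (f : ℝ → ℝ) (hf : f ∈ DenjoyCarleman.carlemanClass A)
    (n : ℕ) (hn : 1 ≤ n) (hdeg : DenjoyCarleman.bangDegree A f = (n : ℕ∞))
    (I : Set ℝ) (hI : I.OrdConnected) (hI01 : I ⊆ Icc 0 1)
    (E : Set ℝ) (hEI : E ⊆ I) (hE : NullMeasurableSet E volume) (hE0 : 0 < volume E) :
    DenjoyCarleman.supNorm f I ≤
      (DenjoyCarleman.GammaA A (2 * n) * volume.real I / volume.real E) ^ (2 * n) *
        DenjoyCarleman.supNorm f E := by
  open DenjoyCarleman in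
  have hn1 : (1 : ℝ) ≤ n := by exact_mod_cast hn
  set γ := gammaA A (2 * n) with hγdef
  have hγ : 0 ≤ γ := gammaA_nonneg hA_pos hA_mono hA_reg (by linarith)
  have hItop : volume I ≠ ⊤ := ((measure_mono hI01).trans_lt (by simp)).ne
  have hEtop : volume E ≠ ⊤ := ((measure_mono hEI).trans_lt hItop.lt_top).ne
  have hErpos : 0 < volume.real E := ENNReal.toReal_pos hE0.ne' hEtop
  have hEX : volume.real E ≤ volume.real I := measureReal_mono hEI hItop
  set e := volume.real E with he
  set X := volume.real I with hX
  have hX0 : 0 < X := hErpos.trans_le hEX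
  have hf1 : ∀ x ∈ Icc (0 : ℝ) 1, |f x| ≤ 1 := fun x hx => by
    have := hf.2 0 x hx
    rwa [iteratedDerivWithin_zero, M_zero] at this
  set δ := supNorm f E with hδ
  have hδ0 : 0 ≤ δ := supNorm_nonneg f E
  have hL : (0 : ℝ) < ((n + 1 : ℕ) : ℝ) := by positivity
  -- Dividing by `n + 1` rather than `n` gives the strict inequality `n d < |E|` required for the
  -- choice of nodes.
  set d := e / ((n + 1 : ℕ) : ℝ) with hd
  have hd0 : 0 < d := div_pos hErpos hL
  obtain ⟨z, hzE, hz⟩ := exists_separated_points hd0.le (k := n)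
    (bddBelow_Icc.mono (hEI.trans hI01)) (by
      rw [← ENNReal.ofReal_toReal hEtop, ← measureReal_def, ← he,
        ENNReal.ofReal_lt_ofReal_iff hErpos]
      show n * d < e
      rw [hd, mul_div_assoc', div_lt_iff₀ hL, mul_comm e]
      push_cast
      nlinarith)
  have hz01 : ∀ i ≤ n, z i ∈ Icc (0 : ℝ) 1 := fun i hi => hI01 (hEI (hzE i hi))
  have hzδ : ∀ i ≤ n, |f (z i)| ≤ δ := fun i hi =>
    abs_le_supNorm (fun x hx => hf1 x (hI01 (hEI hx))) (hzE i hi)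
  have hdiam : ∀ x ∈ I, ∀ y ∈ I, |x - y| ≤ X := fun x hx y hy =>
    abs_sub_le_volume_real hI hI01 hx hy
  have hzX : z n - z 0 ≤ X := (le_abs_self _).trans
    (hdiam _ (hEI (hzE n le_rfl)) _ (hEI (hzE 0 (Nat.zero_le n))))
  set Q := δ * (2 * (X / e)) ^ n with hQdef
  have hQ : 0 ≤ Q := by positivity
  have hQd : δ * (2 / d) ^ n * X ^ n = Q * ((n + 1 : ℕ) : ℝ) ^ n := by
    rw [hQdef, hd, mul_assoc, mul_assoc, ← mul_pow, ← mul_pow]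
    congr 2
    field_simp
  -- The arguments up to `n + 1 ≤ 2n` lie in the range of `γ(2n)`.
  have hAik : ∀ i k : ℕ, 1 ≤ i → i ≤ k → k ≤ n + 1 → A k ≤ A i * ((k : ℝ) / i) ^ γ :=
    fun i k hi hik hk => le_mul_rpow_gammaA hA_pos hA_mono hA_reg (by exact_mod_cast hi)
      (by exact_mod_cast hik) (by exact_mod_cast (show k ≤ 2 * n by omega))
  obtain ⟨j, hj, hlt⟩ := exists_lt_of_bangDegree hA_pos hA_mono hf hn hdeg hd0 hz hz01 hzδ hzX
  have h1 : stepRatio A n j * M A j * X ^ j ≤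
      Q * ((n + 1 : ℕ) : ℝ) ^ j * Real.exp (2 * n + 5) := by
    have hr := stepRatio_pos hA_pos n j
    have hM := M_pos hA_pos j
    have hfac := Real.pow_div_factorial_le_exp (x := ((n + 1 : ℕ) : ℝ)) hL.le (n - j)
    -- The factor `e^j` is given away; `e^(n+4)` and `(n+1)^(n-j)/(n-j)! ≤ e^(n+1)` make up
    -- `e^(2n+5)`.
    have hexp : Real.exp (-(n + 4)) ≤ Real.exp ((j : ℝ) - n - 4) :=
      Real.exp_le_exp.2 (by linarith [(Nat.cast_nonneg j : (0 : ℝ) ≤ j)])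
    have hpw : X ^ (n - j) * X ^ j = X ^ n := by rw [← pow_add]; congr 1; omega
    have hpL : ((n + 1 : ℕ) : ℝ) ^ n = ((n + 1 : ℕ) : ℝ) ^ j * ((n + 1 : ℕ) : ℝ) ^ (n - j) := by
      rw [← pow_add]; congr 1; omega
    calc stepRatio A n j * M A j * X ^ j
        = (stepRatio A n j * Real.exp (-(n + 4)) * M A j) * X ^ j * Real.exp (n + 4) := by
          rw [Real.exp_neg]
          field_simp
      _ ≤ (δ * (2 / d) ^ n * X ^ (n - j) / (n - j).factorial) * X ^ j * Real.exp (n + 4) := by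
          gcongr
          refine le_trans ?_ hlt.le
          gcongr
      _ = (δ * (2 / d) ^ n * X ^ n) / (n - j).factorial * Real.exp (n + 4) := by
          rw [← hpw]; ring
      _ = Q * ((n + 1 : ℕ) : ℝ) ^ j * (((n + 1 : ℕ) : ℝ) ^ (n - j) / (n - j).factorial) *
            Real.exp (n + 4) := by
          rw [hQd, hpL]; ring
      _ ≤ Q * ((n + 1 : ℕ) : ℝ) ^ j * Real.exp ((n + 1 : ℕ) : ℝ) * Real.exp (n + 4) := by gcongr
      _ = _ := by
          rw [mul_assoc, ← Real.exp_add]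
          congr 2
          push_cast
          ring
  have hbound : ∀ x ∈ I, |f x| ≤ Q * (8 ^ n * Real.exp (8 * n + 2 * n * γ)) := by
    intro x hx
    refine le_mul_exp_of_bounds hA_pos hA_mono hγ hAik hn hQ hX0 (hf1 x (hI01 hx)) hj h1 ?_
    have h2 := abs_le_of_interpolation hA_pos hf hd0 hz hz01 hzδ (hI01 hx)
      (fun i hi => hdiam x hx _ (hEI (hzE i hi))) hzX
    have hfac := Real.pow_div_factorial_le_exp (x := ((n + 1 : ℕ) : ℝ)) hL.le n
    refine h2.trans (add_le_add_left ?_ _)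
    rw [hQd, mul_div_assoc]
    push_cast at hfac ⊢
    gcongr
  refine (supNorm_le (by positivity) hbound).trans ?_
  rw [hQdef, GammaA, mul_comm _ δ, mul_assoc]
  refine mul_le_mul_of_nonneg_left ?_ hδ0
  have hρ : 1 ≤ X / e := (one_le_div hErpos).2 hEX
  have hexp : Real.exp (8 * n + 2 * n * γ) = Real.exp (4 + γ) ^ (2 * n) := by
    rw [← Real.exp_nat_mul]
    congr 1
    push_cast
    ring
  -- The `2^n` in `Q` and the `8^n` above give `4^(2n)`, and `(|I|/|E|)^n` is raised to the power
  -- `2n` since `|I| ≥ |E|`.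
  have h16 : (4 : ℝ) ^ (2 * n) = 2 ^ n * 8 ^ n := by
    rw [pow_mul, ← mul_pow]
    norm_num
  rw [mul_div_assoc, mul_pow, mul_pow, mul_pow, h16, hexp]
  calc 2 ^ n * (X / e) ^ n * (8 ^ n * Real.exp (4 + γ) ^ (2 * n))
      = 2 ^ n * 8 ^ n * Real.exp (4 + γ) ^ (2 * n) * (X / e) ^ n := by ring
    _ ≤ 2 ^ n * 8 ^ n * Real.exp (4 + γ) ^ (2 * n) * (X / e) ^ (2 * n) := by
        gcongr
        omega
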